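/- **Theorem 3.1.** The CW spheres $E_{mn}=E(C_m\times C_n)$ are polytopal for all $m,n\ge 3$. That is: for all $m,n\ge3$, every convex $m$-gon $C_m\subset\mathbb R^2$ and every convex $n$-gon $C_n\subset\mathbb R^2$, there is a $4$-dimensional convex polytope in $\mathbb R^4$ whose face lattice is isomorphic to the face lattice of the sphere $E(C_m\times C_n)$. Here, for a $d$-polytope $P$ with $d\ge 2$, the CW sphere $E(P)$ is obtained from the boundary of $P$ by stellarly subdividing all facets of $P$ and then, for every ridge $R$ of $P$ (a face of dimension $d-2$), merging the two facets of the subdivision that contain $R$ into one facet (a bipyramid over $R$). Its face lattice, including the empty face and the whole sphere as improper elements, is described as follows. Let $L(P)$ be the face lattice of $P$, including $\emptyset$ and $P$. The face lattice of $E(P)$ consists of the following subsets of $L(P)$, ordered by reverse inclusion: the empty set, the one-element sets $\{R\}$ for the ridges $R$ of $P$, and the intervals $[G,F]=\{X\in L(P): G\subseteq X\subseteq F\}$ with $G,F\in L(P)$ for which some ridge $R$ of $P$ satisfies $G\subsetneq R\subsetneq F$. -/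

import Mathlib

namespace EConstruction

section General

variable {V : Type*} [AddCommGroup V] [Module ℝ V]

/-- A (convex) polytope: the convex hull of a finite set of points. -/
def IsPolytope (P : Set V) : Prop :=
  ∃ S : Finset V, P = convexHull ℝ (S : Set V)

/-- The dimension of a nonempty set: the dimension of its affine hull.  (The junk value for the
empty set is `0`, so nonemptiness is always asked for separately below.) -/
noncomputable def dim (P : Set V) : ℕ :=
  Module.finrank ℝ (vectorSpan ℝ P)

variable [TopologicalSpace V]

/-- The face lattice of `P`, ordered by inclusion: the sets of maximisers on `P` of the (continuous)
linear functionals, together with the empty face.  The zero functional gives the face `P`. -/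
abbrev Face (P : Set V) : Type _ :=
  {F : Set V // IsExposed ℝ P F}

/-- The ridges of `P`: the (nonempty) faces of codimension two. -/
def IsRidge (P : Set V) (F : Face P) : Prop :=
  (F : Set V).Nonempty ∧ dim (F : Set V) + 2 = dim P

/-- The faces of the sphere `E(P)`, including the improper ones, as subsets of the face lattice of
the `d`-polytope `P`.  The stellar subdivision of all facets, followed by the merging of the two
facets of the subdivision at every ridge of `P`, leaves the following cells:
* `[G, P]` is the face `G` of `P`, where `G` has dimension at most `d - 3` (`[∅, P]` is the
  empty cell),
* `[G, F]` is the cone over a face `G` of dimension at most `d - 3` of a facet `F`, with apex the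
  new vertex of `F` (`[∅, F]` is this new vertex),
* `{R}` is the bipyramid over the ridge `R`, with apices the new vertices of the two facets at `R`,
* `∅` is the improper cell, the whole sphere.

One cell lies in another one exactly if its subset contains the subset of the other one. -/
inductive IsECell (P : Set V) : Set (Face P) → Prop
  | top : IsECell P ∅
  | ridge (R : Face P) (hR : IsRidge P R) : IsECell P {R}
  | interval (G R F : Face P) (hR : IsRidge P R) (hGR : G < R) (hRF : R < F) :
      IsECell P (Set.Icc G F)

/-- The face lattice of the sphere `E(P)`: its cells (with a bottom and a top element), ordered by
reverse inclusion of the corresponding subsets of the face lattice of `P`. -/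
abbrev ESphere (P : Set V) : Type _ :=
  {A : Set (Face P) // IsECell P A}ᵒᵈ

end General

/-- The face lattice `L` of a sphere is polytopal, of dimension `d - 1`: it is isomorphic to the face
lattice of a `d`-dimensional polytope in `ℝ^d`. -/
def IsPolytopal (d : ℕ) (L : Type*) [PartialOrder L] : Prop :=
  ∃ Q : Set (EuclideanSpace ℝ (Fin d)),
    IsPolytope Q ∧ dim Q = d ∧ Nonempty (L ≃o Face Q)

/-- `c` lies strictly to the left of the directed line from `a` to `b`. -/
def IsLeft (a b c : EuclideanSpace ℝ (Fin 2)) : Prop :=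
  0 < (b 0 - a 0) * (c 1 - a 1) - (b 1 - a 1) * (c 0 - a 0)

/-- `C` is a convex `m`-gon (`m ≥ 3`): the convex hull of points `v i`, with indices modulo `m`,
that are numbered consecutively in counterclockwise order, such that for each edge `v i, v (i + 1)`
all other vertices lie strictly to the left of it. -/
def IsPolygon (m : ℕ) (C : Set (EuclideanSpace ℝ (Fin 2))) : Prop :=
  ∃ v : ZMod m → EuclideanSpace ℝ (Fin 2),
    (∀ i j : ZMod m, j ≠ i → j ≠ i + 1 → IsLeft (v i) (v (i + 1)) (v j)) ∧
    C = convexHull ℝ (Set.range v)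

end EConstruction

/-! The vertices of E(C × D) are the mn vertices of C × D and one apex over each of its m + n
facets. They are realized in ℝ⁴ by the points (v i, v' j), (a i, 0) and (0, a' j) (`labelPoint`).
Here the m-gon of the v i is inscribed in the m-gon of the a i, with one vertex on each edge, and
likewise for v' and a' (`InscribedPair`). The shapes of C and D play no role: only the face lattice
of the product enters.

A functional (u, w) has the maxima c + c', d and d' on the three kinds of points, where c and d are
the maxima of u on the inner and the outer m-gon, and c', d' those of w. The normals g i, h i, g (i
+ 1) cut the plane into cones on which the maximisers are constant. Because h i is twice as large at
a i as on the inner edge that cuts a i off, c ≤ d ≤ 2c. For u ≠ 0, d = c holds exactly for the outer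
normals and d = 2c exactly for the inner ones. Comparing the three maxima under these inequalities
yields exactly the cells of the sphere. For instance d = d' > c + c' is impossible, and d = d' = c +
c' > 0 forces two inner normals, which is the bipyramid over edge × edge; for w = 0 the equality d =
c + c' forces an outer normal, which is the bipyramid over vertex × polygon
(`isCellLabels_of_attains`, and conversely `IsCellLabels.exists_isSupport`). Both lattices embed
into the sets of labels with the same image, hence are isomorphic.

It remains to find an inscribed pair for every m. Let σ = 1/√2, a i = z (2i) and v i = σ z (2i - 1).
Then both requirements become one: in a closed chain of 2m points winding once around the origin, σ
z k lies between z (k - 1) and z (k + 1). This local condition implies the global ones. The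
functional that is 1 at z (k ± 1) is 1/σ = 2σ at z k; by the recurrence its values shrink by the
factor σ at every further step while they stay positive; and its positive values occupy a cyclic
interval, so it is below 1 at all other points (`IsCyclicChain.lt_one_or`). For m ≥ 4 a
mirror-symmetric chain is grown with a constant parameter and closed by the last two parameters
(`exists_isHalfChain`); the triangle is given by coordinates. -/

namespace EConstruction

/-- Two posets that embed onto the same subset of a poset are isomorphic. -/
theorem nonempty_orderIso_of_range_eq {α β γ : Type*} [PartialOrder α] [PartialOrder β]
    [PartialOrder γ] (f : α ↪o γ) (g : β ↪o γ) (h : Set.range f = Set.range g) :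
    Nonempty (α ≃o β) :=
  ⟨f.orderIso.trans ((OrderIso.setCongr _ _ h).trans g.orderIso.symm)⟩

/-- The indices at which a real-valued function is maximal. -/
def argmax {ι : Type*} (f : ι → ℝ) : Set ι := {i | ∀ j, f j ≤ f i}

/-! ### Faces of a convex hull as sets of maximising generators -/

section Hull

variable {V ι : Type*} [AddCommGroup V] [Module ℝ V]

theorem le_of_mem_convexHull_range {S : ι → V} {l : V →ₗ[ℝ] ℝ} {c : ℝ} (h : ∀ i, l (S i) ≤ c)
    {x : V} (hx : x ∈ convexHull ℝ (Set.range S)) : l x ≤ c := by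
  have : convexHull ℝ (Set.range S) ⊆ {y | l y ≤ c} :=
    convexHull_min (by rintro _ ⟨i, rfl⟩; exact h i) (convex_halfSpace_le l.isLinear c)
  exact this hx

/-- A point of a convex hull that maximises a functional is in the hull of the maximising
generators. -/
theorem mem_convexHull_image_of_le {S : ι → V} {l : V →ₗ[ℝ] ℝ} {c : ℝ} (h : ∀ i, l (S i) ≤ c)
    {x : V} (hx : x ∈ convexHull ℝ (Set.range S)) (hc : c ≤ l x) :
    x ∈ convexHull ℝ (S '' {i | l (S i) = c}) := by
  set K := convexHull ℝ (S '' {i | l (S i) = c}) with hK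
  have hKc : ∀ y ∈ K, l y ≤ c := fun y hy ↦
    (convexHull_min (by rintro _ ⟨i, hi, rfl⟩; exact h i)
      (convex_halfSpace_le l.isLinear c) : K ⊆ {y | l y ≤ c}) hy
  -- A proper mixture of a point with `l < c` and one with `l ≤ c` has `l < c`, so adding the open
  -- half-space to `K` keeps convexity. The union contains all generators, hence the hull.
  have hconv : Convex ℝ (K ∪ {y | l y < c}) := by
    rw [convex_iff_forall_pos]
    have key : ∀ y z : V, ∀ a b : ℝ, 0 < a → 0 < b → a + b = 1 → l y < c → l z ≤ c →
        l (a • y + b • z) < c := by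
      intro y z a b ha hb hab hy hz
      simp only [map_add, map_smul, smul_eq_mul]
      have := mul_lt_mul_of_pos_left hy ha
      have := mul_le_mul_of_nonneg_left hz hb.le
      have : a * c + b * c = c := by rw [← add_mul, hab, one_mul]
      linarith
    rintro y (hy | hy) z (hz | hz) a b ha hb hab
    · exact Or.inl (convex_convexHull ℝ _ hy hz ha.le hb.le hab)
    · right
      rw [add_comm]
      exact key z y b a hb ha (by rw [add_comm, hab]) hz (hKc y hy)
    · exact Or.inr (key y z a b ha hb hab hy (hKc z hz))
    · exact Or.inr (key y z a b ha hb hab hy (le_of_lt hz))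
  have hsub : convexHull ℝ (Set.range S) ⊆ K ∪ {y | l y < c} := by
    refine convexHull_min ?_ hconv
    rintro _ ⟨i, rfl⟩
    rcases (h i).lt_or_eq with hi | hi
    · exact Or.inr hi
    · exact Or.inl (subset_convexHull ℝ _ ⟨i, hi, rfl⟩)
  rcases hsub hx with h1 | h1
  · exact h1
  · exact absurd h1 (not_lt.2 hc)

end Hull

section Faces

variable {V ι : Type*} [AddCommGroup V] [Module ℝ V] [TopologicalSpace V]

/-- A face of the convex hull of a family of points is spanned by the points that it contains. -/
theorem face_eq_convexHull (S : ι → V) (F : Face (convexHull ℝ (Set.range S))) :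
    (F : Set V) = convexHull ℝ (S '' {i | S i ∈ (F : Set V)}) := by
  obtain ⟨F, hF⟩ := F
  refine Set.Subset.antisymm ?_
    (convexHull_min (by rintro _ ⟨i, hi, rfl⟩; exact hi) (hF.convex (convex_convexHull ℝ _)))
  intro x hx
  obtain ⟨l, hl⟩ := hF ⟨x, hx⟩
  have hx' := hx
  simp only at hx'
  rw [hl] at hx'
  have hle : ∀ i, l.toLinearMap (S i) ≤ l x := fun i ↦
    hx'.2 _ (subset_convexHull ℝ _ ⟨i, rfl⟩)
  refine convexHull_mono (Set.image_mono ?_) (mem_convexHull_image_of_le hle hx'.1 le_rfl)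
  intro i hi
  have hi' : l (S i) = l x := hi
  simp only [Set.mem_ofPred_eq]
  rw [hl]
  exact ⟨subset_convexHull ℝ _ ⟨i, rfl⟩, fun y hy ↦ by rw [hi']; exact hx'.2 y hy⟩

/-- Faces of a convex hull, as sets of indices of generators. -/
def vertexEmbedding (S : ι → V) : Face (convexHull ℝ (Set.range S)) ↪o Set ι :=
  OrderEmbedding.ofMapLEIff (fun F ↦ {i | S i ∈ (F : Set V)}) (by
    intro F G
    constructor
    · intro h
      change (F : Set V) ⊆ G
      rw [face_eq_convexHull S F, face_eq_convexHull S G]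
      exact convexHull_mono (Set.image_mono h)
    · intro h i hi
      exact h hi)

theorem mem_vertexEmbedding (S : ι → V) (F : Face (convexHull ℝ (Set.range S))) (i : ι) :
    i ∈ vertexEmbedding S F ↔ S i ∈ (F : Set V) := Iff.rfl

theorem range_vertexEmbedding (S : ι → V) :
    Set.range (vertexEmbedding S) =
      {A | A = ∅ ∨ (A.Nonempty ∧ ∃ l : StrongDual ℝ V, A = argmax (fun i ↦ l (S i)))} := by
  have key : ∀ l : StrongDual ℝ V, ∀ i, S i ∈ {x ∈ convexHull ℝ (Set.range S) |
      ∀ y ∈ convexHull ℝ (Set.range S), l y ≤ l x} ↔ i ∈ argmax (fun i ↦ l (S i)) := by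
    intro l i
    constructor
    · exact fun h j ↦ h.2 _ (subset_convexHull ℝ _ ⟨j, rfl⟩)
    · exact fun h ↦ ⟨subset_convexHull ℝ _ ⟨i, rfl⟩, fun y hy ↦
        le_of_mem_convexHull_range (l := l.toLinearMap) h hy⟩
  ext A
  constructor
  · rintro ⟨F, rfl⟩
    rcases (vertexEmbedding S F).eq_empty_or_nonempty with h | h
    · exact Or.inl h
    · obtain ⟨i, hi⟩ := h
      obtain ⟨l, hl⟩ := F.2 ⟨S i, hi⟩
      refine Or.inr ⟨⟨i, hi⟩, l, ?_⟩
      ext j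
      rw [mem_vertexEmbedding, hl]
      exact key l j
  · rintro (rfl | ⟨-, l, rfl⟩)
    · exact ⟨⟨∅, fun h ↦ absurd h Set.not_nonempty_empty⟩, rfl⟩
    · refine ⟨⟨_, fun _ ↦ ⟨l, rfl⟩⟩, ?_⟩
      ext i
      exact key l i

end Faces

/-! ### Polygons through their edge normals -/

section Support

variable {ι : Type*} {f g : ι → ℝ} {c d : ℝ} {K L : Set ι}

/-- `c` is an upper bound of `f` that is attained exactly on `K`. -/
def IsSupport (f : ι → ℝ) (c : ℝ) (K : Set ι) : Prop :=
  ∀ j, f j ≤ c ∧ (f j = c ↔ j ∈ K)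

theorem IsSupport.argmax_eq (h : IsSupport f c K) (hK : K.Nonempty) : argmax f = K := by
  obtain ⟨k, hk⟩ := hK
  ext i
  constructor
  · intro hi
    exact (h i).2.1 (le_antisymm (h i).1 (((h k).2.2 hk).symm.le.trans (hi k)))
  · intro hi j
    rw [(h i).2.2 hi]
    exact (h j).1

theorem isSupport_zero : IsSupport (fun _ : ι ↦ (0 : ℝ)) 0 Set.univ := fun _ ↦ by simp

theorem IsSupport.smul (h : IsSupport f c K) {p : ℝ} (hp : 0 < p) :
    IsSupport (fun j ↦ p * f j) (p * c) K := fun j ↦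
  ⟨mul_le_mul_of_nonneg_left (h j).1 hp.le, by rw [mul_right_inj' hp.ne']; exact (h j).2⟩

theorem IsSupport.add (hf : IsSupport f c K) (hg : IsSupport g d L) :
    IsSupport (fun j ↦ f j + g j) (c + d) (K ∩ L) := by
  intro j
  have h1 := (hf j).1
  have h2 := (hg j).1
  refine ⟨add_le_add h1 h2, ?_⟩
  rw [Set.mem_inter_iff, ← (hf j).2, ← (hg j).2]
  constructor
  · intro h
    constructor <;> linarith
  · rintro ⟨h3, h4⟩
    exact congrArg₂ _ h3 h4

theorem IsSupport.congr (h : IsSupport f c K) {f' : ι → ℝ} {c' : ℝ} {K' : Set ι}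
    (hf : ∀ j, f' j = f j) (hc : c' = c) (hK : K' = K) : IsSupport f' c' K' := by
  obtain rfl : f' = f := funext hf
  subst hc hK
  exact h

end Support

/-- The standard bilinear form of the plane. -/
def dot (u p : ℝ × ℝ) : ℝ := u.1 * p.1 + u.2 * p.2

theorem dot_add_smul (p q : ℝ) (u w x : ℝ × ℝ) :
    dot (p • u + q • w) x = p * dot u x + q * dot w x := by
  simp only [dot, Prod.fst_add, Prod.snd_add, Prod.smul_fst, Prod.smul_snd, smul_eq_mul]
  ring

theorem eq_zero_of_dot {g h x y w : ℝ × ℝ} (hgx : dot g x = 0) (hgy : dot g y ≠ 0)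
    (hhx : dot h x ≠ 0) (hwx : dot w x = 0) (hwy : dot w y = 0) : w = 0 := by
  -- If `x` and `y` were dependent, the identity below would give `dot g y * dot h x = dot g x * dot
  -- h y = 0`.
  have hdet : x.1 * y.2 - x.2 * y.1 ≠ 0 := by
    intro hd
    have h1 : dot g y * dot h x = 0 := by
      have : dot g y * dot h x = dot g x * dot h y - (g.1 * h.2 - g.2 * h.1) *
        (x.1 * y.2 - x.2 * y.1) := by simp only [dot]; ring
      rw [this, hd, hgx]; ring
    rcases mul_eq_zero.1 h1 with h | h
    · exact hgy h
    · exact hhx h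
  simp only [dot] at hwx hwy
  have h1 : w.1 * (x.1 * y.2 - x.2 * y.1) = 0 := by
    linear_combination y.2 * hwx - x.2 * hwy
  have h2 : w.2 * (x.1 * y.2 - x.2 * y.1) = 0 := by
    linear_combination x.1 * hwy - y.1 * hwx
  exact Prod.ext ((mul_eq_zero.1 h1).resolve_right hdet) ((mul_eq_zero.1 h2).resolve_right hdet)

section ZMod

variable {m : ℕ}

theorem zmod_one_ne_zero (hm : 3 ≤ m) : (1 : ZMod m) ≠ 0 := by
  have : Fact (1 < m) := ⟨by omega⟩
  exact one_ne_zero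

theorem zmod_two_ne_zero (hm : 3 ≤ m) : (2 : ZMod m) ≠ 0 := by
  intro h
  have h' : ((2 : ℕ) : ZMod m) = 0 := by exact_mod_cast h
  rw [ZMod.natCast_eq_zero_iff] at h'
  exact absurd (Nat.le_of_dvd (by norm_num) h') (by omega)

theorem add_one_ne_self (hm : 3 ≤ m) (i : ZMod m) : i + 1 ≠ i := by
  simpa using zmod_one_ne_zero hm

theorem sub_one_ne_self (hm : 3 ≤ m) (i : ZMod m) : i - 1 ≠ i := by
  simpa using zmod_one_ne_zero hm

theorem sub_one_ne_add_one (hm : 3 ≤ m) (i : ZMod m) : i - 1 ≠ i + 1 := by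
  intro h
  apply zmod_two_ne_zero hm
  linear_combination -h

theorem edge_inter_edge (hm : 3 ≤ m) (i : ZMod m) :
    ({i - 1, i} : Set (ZMod m)) ∩ {i, i + 1} = {i} := by
  ext j
  simp only [Set.mem_inter_iff, Set.mem_insert_iff, Set.mem_singleton_iff]
  constructor
  · rintro ⟨rfl | rfl, h | h⟩
    · exact h
    · exact absurd h (sub_one_ne_add_one hm i)
    · rfl
    · rfl
  · rintro rfl
    simp

/-- The normal vectors of the edges of a polygon form a complete fan. -/
theorem exists_conic_combination (hm : 3 ≤ m) {a g : ZMod m → ℝ × ℝ} {c : ZMod m → ℝ}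
    (h : ∀ i, IsSupport (fun j ↦ dot (g i) (a j)) (c i) {i - 1, i}) {u : ℝ × ℝ} {i : ZMod m}
    (hi : i ∈ argmax (fun j ↦ dot u (a j))) :
    ∃ p q : ℝ, 0 ≤ p ∧ 0 ≤ q ∧ u = p • g i + q • g (i + 1) := by
  have hsub : ∀ w x y : ℝ × ℝ, dot w (x - y) = dot w x - dot w y := fun w x y ↦ by
    simp only [dot, Prod.fst_sub, Prod.snd_sub]; ring
  have e1 : dot (g i) (a i) = c i := ((h i) i).2.2 (by simp)
  have e2 : dot (g i) (a (i - 1)) = c i := ((h i) (i - 1)).2.2 (by simp)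
  have e3 : dot (g i) (a (i + 1)) < c i := by
    refine lt_of_le_of_ne ((h i) (i + 1)).1 fun he ↦ ?_
    rcases ((h i) (i + 1)).2.1 he with h' | h'
    · exact sub_one_ne_add_one hm i h'.symm
    · exact add_one_ne_self hm i h'
  have e4 : dot (g (i + 1)) (a i) = c (i + 1) := ((h (i + 1)) i).2.2 (by simp)
  have e5 : dot (g (i + 1)) (a (i + 1)) = c (i + 1) := ((h (i + 1)) (i + 1)).2.2 (by simp)
  have e6 : dot (g (i + 1)) (a (i - 1)) < c (i + 1) := by
    refine lt_of_le_of_ne ((h (i + 1)) (i - 1)).1 fun he ↦ ?_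
    rcases ((h (i + 1)) (i - 1)).2.1 he with h' | h'
    · exact sub_one_ne_self hm i (by simpa using h')
    · exact sub_one_ne_add_one hm i h'
  have hux : dot u (a (i - 1) - a i) ≤ 0 := by rw [hsub]; linarith [hi (i - 1)]
  have huy : dot u (a (i + 1) - a i) ≤ 0 := by rw [hsub]; linarith [hi (i + 1)]
  have hgx : dot (g i) (a (i - 1) - a i) = 0 := by rw [hsub]; linarith
  have hgy : dot (g i) (a (i + 1) - a i) < 0 := by rw [hsub]; linarith
  have hhx : dot (g (i + 1)) (a (i - 1) - a i) < 0 := by rw [hsub]; linarith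
  have hhy : dot (g (i + 1)) (a (i + 1) - a i) = 0 := by rw [hsub]; linarith
  set x := a (i - 1) - a i
  set y := a (i + 1) - a i
  -- `g i` vanishes on the edge vector `x` and `g (i + 1)` on `y`, so evaluating at `y` and `x`
  -- isolates the two coefficients. Both are quotients of nonpositive by negative numbers, because
  -- `i` is a maximiser.
  refine ⟨dot u y / dot (g i) y, dot u x / dot (g (i + 1)) x,
    div_nonneg_of_nonpos huy hgy.le, div_nonneg_of_nonpos hux hhx.le, ?_⟩
  rw [← sub_eq_zero]
  have hlin : ∀ (p q : ℝ) (w z : ℝ × ℝ) (t : ℝ × ℝ), dot (u - (p • w + q • z)) t =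
      dot u t - (p * dot w t + q * dot z t) := fun p q w z t ↦ by
    rw [← dot_add_smul]; simp only [dot, Prod.fst_sub, Prod.snd_sub]; ring
  refine eq_zero_of_dot hgx hgy.ne hhx.ne ?_ ?_
  · rw [hlin, hgx, div_mul_cancel₀ _ hhx.ne]; ring
  · rw [hlin, hhy, div_mul_cancel₀ _ hgy.ne]; ring

/-- The index sets of the nonempty faces of an `m`-gon. -/
inductive IsPolygonFace : Set (ZMod m) → Prop
  | vertex (i : ZMod m) : IsPolygonFace {i}
  | edge (i : ZMod m) : IsPolygonFace {i, i + 1}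
  | univ : IsPolygonFace Set.univ

/-- The face depends only on which of the two conic coefficients vanish: both for the whole polygon,
one for an edge, none for a vertex. -/
theorem isPolygonFace_argmax (hm : 3 ≤ m) {a g : ZMod m → ℝ × ℝ} {c : ZMod m → ℝ}
    (h : ∀ i, IsSupport (fun j ↦ dot (g i) (a j)) (c i) {i - 1, i}) (u : ℝ × ℝ) :
    IsPolygonFace (argmax (fun j ↦ dot u (a j))) := by
  have : NeZero m := ⟨by omega⟩
  obtain ⟨i, hi⟩ := Finite.exists_max (fun j ↦ dot u (a j))
  obtain ⟨p, q, hp, hq, rfl⟩ := exists_conic_combination hm h hi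
  have h1 := h i
  have h2 := h (i + 1)
  rw [add_sub_cancel_right] at h2
  simp only [dot_add_smul]
  rcases hp.eq_or_lt with rfl | hp
  · rcases hq.eq_or_lt with rfl | hq
    · simp only [zero_mul, add_zero]
      rw [isSupport_zero.argmax_eq Set.univ_nonempty]
      exact .univ
    · simp only [zero_mul, zero_add]
      rw [(h2.smul hq).argmax_eq ⟨i, by simp⟩]
      exact .edge i
  · rcases hq.eq_or_lt with rfl | hq
    · simp only [zero_mul, add_zero]
      rw [(h1.smul hp).argmax_eq ⟨i, by simp⟩]
      have := IsPolygonFace.edge (i - 1)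
      rwa [sub_add_cancel] at this
    · rw [((h1.smul hp).add (h2.smul hq)).argmax_eq ⟨i, by simp⟩, edge_inter_edge hm]
      exact .vertex i

theorem exists_argmax_eq (hm : 3 ≤ m) {a g : ZMod m → ℝ × ℝ} {c : ZMod m → ℝ}
    (h : ∀ i, IsSupport (fun j ↦ dot (g i) (a j)) (c i) {i - 1, i}) {K : Set (ZMod m)}
    (hK : IsPolygonFace K) : ∃ u : ℝ × ℝ, argmax (fun j ↦ dot u (a j)) = K := by
  have h2 : ∀ i, IsSupport (fun j ↦ dot (g (i + 1)) (a j)) (c (i + 1)) {i, i + 1} := by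
    intro i
    have := h (i + 1)
    rwa [add_sub_cancel_right] at this
  cases hK with
  | vertex i =>
    refine ⟨(1 : ℝ) • g i + (1 : ℝ) • g (i + 1), ?_⟩
    simp only [dot_add_smul]
    rw [(((h i).smul one_pos).add ((h2 i).smul one_pos)).argmax_eq ⟨i, by simp⟩,
      edge_inter_edge hm]
  | edge i => exact ⟨_, (h2 i).argmax_eq ⟨i, by simp⟩⟩
  | univ =>
    refine ⟨0, ?_⟩
    simp [dot, argmax]

end ZMod

/-! ### Inscribed pairs and the common refinement of their normal fans -/

/-- An `m`-gon with vertices `a i`, an inscribed `m`-gon with vertices `v i` on the edges of the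
first one, and the normal vectors `g i` of the edges of the first and `h i` of the edges of the
second one, such that every vertex of the first `m`-gon is twice as high above the edge of the
second `m`-gon that cuts it off as the origin. -/
structure InscribedPair (m : ℕ) where
  (a v g h : ZMod m → ℝ × ℝ)
  support_g_a : ∀ i, IsSupport (fun j ↦ dot (g i) (a j)) 1 {i - 1, i}
  support_g_v : ∀ i, IsSupport (fun j ↦ dot (g i) (v j)) 1 {i}
  support_h_v : ∀ i, IsSupport (fun j ↦ dot (h i) (v j)) 1 {i, i + 1}
  support_h_a : ∀ i, IsSupport (fun j ↦ dot (h i) (a j)) 2 {i}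

/-- The combinatorial types of the maxima of functionals on the two polygons of an inscribed pair:
`K` and `c` are the maximisers and the maximum on the inner polygon, `A` and `d` on the outer one. -/
inductive SupportType {m : ℕ} : Set (ZMod m) → Set (ZMod m) → ℝ → ℝ → Prop
  | zero : SupportType Set.univ Set.univ 0 0
  | outer (i : ZMod m) (c : ℝ) (hc : 0 < c) : SupportType {i} {i - 1, i} c c
  | inner (i : ZMod m) (c : ℝ) (hc : 0 < c) : SupportType {i, i + 1} {i} c (2 * c)
  | left (i : ZMod m) (c d : ℝ) (hc : c < d) (hd : d < 2 * c) : SupportType {i} {i} c d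
  | right (i : ZMod m) (c d : ℝ) (hc : c < d) (hd : d < 2 * c) : SupportType {i + 1} {i} c d

namespace InscribedPair

variable {m : ℕ} (P : InscribedPair m)

theorem support_left (i : ZMod m) {x y : ℝ} (hx : 0 < x) (hy : 0 < y) :
    IsSupport (fun j ↦ dot (x • P.g i + y • P.h i) (P.v j)) (x + y) {i} ∧
    IsSupport (fun j ↦ dot (x • P.g i + y • P.h i) (P.a j)) (x + 2 * y) {i} := by
  constructor
  · refine (((P.support_g_v i).smul hx).add ((P.support_h_v i).smul hy)).congr
      (fun j ↦ dot_add_smul _ _ _ _ _) (by ring) (by simp)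
  · refine (((P.support_g_a i).smul hx).add ((P.support_h_a i).smul hy)).congr
      (fun j ↦ dot_add_smul _ _ _ _ _) (by ring) (by simp)

theorem support_right (i : ZMod m) {x y : ℝ} (hx : 0 < x) (hy : 0 < y) :
    IsSupport (fun j ↦ dot (x • P.g (i + 1) + y • P.h i) (P.v j)) (x + y) {i + 1} ∧
    IsSupport (fun j ↦ dot (x • P.g (i + 1) + y • P.h i) (P.a j)) (x + 2 * y) {i} := by
  constructor
  · refine (((P.support_g_v (i + 1)).smul hx).add ((P.support_h_v i).smul hy)).congr
      (fun j ↦ dot_add_smul _ _ _ _ _) (by ring) (by simp)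
  · refine (((P.support_g_a (i + 1)).smul hx).add ((P.support_h_a i).smul hy)).congr
      (fun j ↦ dot_add_smul _ _ _ _ _) (by ring) (by simp)

theorem support_outer (i : ZMod m) {x : ℝ} (hx : 0 < x) :
    IsSupport (fun j ↦ dot (x • P.g i + (0 : ℝ) • P.h i) (P.v j)) x {i} ∧
    IsSupport (fun j ↦ dot (x • P.g i + (0 : ℝ) • P.h i) (P.a j)) x {i - 1, i} :=
  ⟨((P.support_g_v i).smul hx).congr (fun j ↦ by rw [dot_add_smul]; ring) (by ring) rfl,
    ((P.support_g_a i).smul hx).congr (fun j ↦ by rw [dot_add_smul]; ring) (by ring) rfl⟩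

theorem support_inner (i : ZMod m) (w : ℝ × ℝ) {y : ℝ} (hy : 0 < y) :
    IsSupport (fun j ↦ dot ((0 : ℝ) • w + y • P.h i) (P.v j)) y {i, i + 1} ∧
    IsSupport (fun j ↦ dot ((0 : ℝ) • w + y • P.h i) (P.a j)) (2 * y) {i} :=
  ⟨((P.support_h_v i).smul hy).congr (fun j ↦ by rw [dot_add_smul]; ring) (by ring) rfl,
    ((P.support_h_a i).smul hy).congr (fun j ↦ by rw [dot_add_smul]; ring) (by ring) rfl⟩

theorem exists_functional {K A : Set (ZMod m)} {c d : ℝ} (h : SupportType K A c d) :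
    ∃ u : ℝ × ℝ, IsSupport (fun j ↦ dot u (P.v j)) c K ∧
      IsSupport (fun j ↦ dot u (P.a j)) d A := by
  cases h with
  | zero =>
    exact ⟨0, isSupport_zero.congr (fun j ↦ by simp [dot]) rfl rfl,
      isSupport_zero.congr (fun j ↦ by simp [dot]) rfl rfl⟩
  | outer i c hc => exact ⟨_, P.support_outer i hc⟩
  | inner i c hc => exact ⟨_, P.support_inner i 0 hc⟩
  | left i c d hc hd =>
    -- The weights solve `x + y = c` and `x + 2 * y = d`.
    have := P.support_left i (x := 2 * c - d) (y := d - c) (by linarith) (by linarith)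
    exact ⟨_, this.1.congr (fun _ ↦ rfl) (by ring) rfl, this.2.congr (fun _ ↦ rfl) (by ring) rfl⟩
  | right i c d hc hd =>
    have := P.support_right i (x := 2 * c - d) (y := d - c) (by linarith) (by linarith)
    exact ⟨_, this.1.congr (fun _ ↦ rfl) (by ring) rfl, this.2.congr (fun _ ↦ rfl) (by ring) rfl⟩

/-- `u` lies in the cone of `g i` and `g (i + 1)` for a maximising vertex `a i`. The ray of `h i`
runs in the interior of this cone and cuts it in two. -/
theorem exists_combination (hm : 3 ≤ m) (u : ℝ × ℝ) : ∃ (i : ZMod m) (x y : ℝ), 0 ≤ x ∧ 0 ≤ y ∧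
    (u = x • P.g i + y • P.h i ∨ u = x • P.g (i + 1) + y • P.h i) := by
  have : NeZero m := ⟨by omega⟩
  obtain ⟨i, hi⟩ := Finite.exists_max (fun j ↦ dot u (P.a j))
  obtain ⟨p, q, hp, hq, hu⟩ := exists_conic_combination hm P.support_g_a hi
  have hi' : i ∈ argmax (fun j ↦ dot (P.h i) (P.a j)) := by
    rw [(P.support_h_a i).argmax_eq ⟨i, rfl⟩]; rfl
  obtain ⟨p', q', hp', hq', hh⟩ := exists_conic_combination hm P.support_g_a hi'
  have e1 : dot (P.h i) (P.a i) = 2 := (P.support_h_a i i).2.2 rfl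
  have e2 : dot (P.g i) (P.a i) = 1 := (P.support_g_a i i).2.2 (by simp)
  have e3 : dot (P.g (i + 1)) (P.a i) = 1 := (P.support_g_a (i + 1) i).2.2 (by simp)
  have e4 : dot (P.g i) (P.a (i - 1)) = 1 := (P.support_g_a i (i - 1)).2.2 (by simp)
  have e5 : dot (P.g (i + 1)) (P.a (i + 1)) = 1 :=
    (P.support_g_a (i + 1) (i + 1)).2.2 (by simp)
  have hsum : p' + q' = 2 := by
    rw [hh, dot_add_smul, e2, e3] at e1
    linarith
  -- Without a `g i` part, `h i` would equal `2 • g (i + 1)` and take the value 2 also at `a (i +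
  -- 1)`. The other coefficient is treated in the same way at `a (i - 1)`.
  have hp0 : 0 < p' := by
    refine lt_of_le_of_ne hp' fun h0 ↦ add_one_ne_self hm i ((P.support_h_a i (i + 1)).2.1 ?_)
    change dot _ _ = _
    rw [hh, dot_add_smul, e5, ← h0]
    linarith
  have hq0 : 0 < q' := by
    refine lt_of_le_of_ne hq' fun h0 ↦ sub_one_ne_self hm i ((P.support_h_a i (i - 1)).2.1 ?_)
    change dot _ _ = _
    rw [hh, dot_add_smul, e4, ← h0]
    linarith
  -- The sign decides on which side of the ray of `h i` the vector `u` lies; the multiple of `h i`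
  -- that removes the other outer normal is split off.
  rcases le_total (q * p') (p * q') with hle | hle
  · refine ⟨i, p - p' * (q / q'), q / q', ?_, by positivity, Or.inl ?_⟩
    · rw [sub_nonneg, ← mul_div_assoc, div_le_iff₀ hq0]
      linarith
    · rw [hh, hu]
      ext <;> simp <;> field_simp <;> ring
  · refine ⟨i, q - q' * (p / p'), p / p', ?_, by positivity, Or.inr ?_⟩
    · rw [sub_nonneg, ← mul_div_assoc, div_le_iff₀ hp0]
      linarith
    · rw [hh, hu]
      ext <;> simp <;> field_simp <;> ring

theorem exists_supportType (hm : 3 ≤ m) (u : ℝ × ℝ) :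
    ∃ K A c d, SupportType K A c d ∧ IsSupport (fun j ↦ dot u (P.v j)) c K ∧
      IsSupport (fun j ↦ dot u (P.a j)) d A ∧ (c = 0 → u = 0) := by
  obtain ⟨i, x, y, hx, hy, h | h⟩ := P.exists_combination hm u
  all_goals
    rcases hx.eq_or_lt with rfl | hx
    · rcases hy.eq_or_lt with rfl | hy
      · have h0 : u = 0 := by simp [h]
        refine ⟨_, _, _, _, .zero, ?_, ?_, fun _ ↦ h0⟩ <;>
        exact isSupport_zero.congr (fun j ↦ by simp [h0, dot]) rfl rfl
      · have hs := P.support_inner i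
        refine ⟨_, _, _, _, .inner i y hy, h ▸ (hs _ hy).1, h ▸ (hs _ hy).2,
          fun h' ↦ absurd h' hy.ne'⟩
  · rcases hy.eq_or_lt with rfl | hy
    · exact ⟨_, _, _, _, .outer i x hx, h ▸ (P.support_outer i hx).1,
        h ▸ (P.support_outer i hx).2, fun h' ↦ absurd h' hx.ne'⟩
    · exact ⟨_, _, _, _, .left i (x + y) (x + 2 * y) (by linarith) (by linarith),
        h ▸ (P.support_left i hx hy).1, h ▸ (P.support_left i hx hy).2,
        fun h' ↦ absurd h' (by positivity)⟩
  · rcases hy.eq_or_lt with rfl | hy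
    · have h' : u = x • P.g (i + 1) + (0 : ℝ) • P.h (i + 1) := by rw [h]; simp
      exact ⟨_, _, _, _, .outer (i + 1) x hx, h' ▸ (P.support_outer (i + 1) hx).1,
        h' ▸ (P.support_outer (i + 1) hx).2, fun h' ↦ absurd h' hx.ne'⟩
    · exact ⟨_, _, _, _, .right i (x + y) (x + 2 * y) (by linarith) (by linarith),
        h ▸ (P.support_right i hx hy).1, h ▸ (P.support_right i hx hy).2,
        fun h' ↦ absurd h' (by positivity)⟩

end InscribedPair

section ZMod

variable {m : ℕ}

theorem IsPolygonFace.nonempty {K : Set (ZMod m)} (h : IsPolygonFace K) : K.Nonempty := by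
  cases h with
  | vertex i => exact Set.singleton_nonempty i
  | edge i => exact ⟨i, by simp⟩
  | univ => exact Set.univ_nonempty

theorem mem_edge {i j : ZMod m} : j ∈ ({i, i + 1} : Set (ZMod m)) ↔ i = j ∨ i = j - 1 := by
  simp only [Set.mem_insert_iff, Set.mem_singleton_iff, eq_sub_iff_add_eq]
  rw [eq_comm, @eq_comm _ j (i + 1)]

theorem not_univ_subset_edge (hm : 3 ≤ m) (i : ZMod m) :
    ¬ (Set.univ : Set (ZMod m)) ⊆ {i, i + 1} := fun h ↦ by
  rcases h (Set.mem_univ (i - 1)) with h' | h'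
  · exact sub_one_ne_self hm i h'
  · exact sub_one_ne_add_one hm i h'

theorem edge_subset_edge (hm : 3 ≤ m) {i k : ZMod m} (h : ({i, i + 1} : Set (ZMod m)) ⊆ {k, k + 1}) :
    k = i := by
  rcases mem_edge.1 (h (Set.mem_insert i _)) with h1 | h1
  · exact h1
  · rcases mem_edge.1 (h (Set.mem_insert_of_mem i rfl)) with h2 | h2
    · exact absurd (h1.symm.trans h2) (sub_one_ne_add_one hm i)
    · rwa [add_sub_cancel_right] at h2

theorem not_edge_subset_singleton (hm : 3 ≤ m) (i k : ZMod m) :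
    ¬ ({i, i + 1} : Set (ZMod m)) ⊆ {k} := fun h ↦ by
  have h1 : i = k := h (Set.mem_insert i _)
  have h2 : i + 1 = k := h (Set.mem_insert_of_mem i rfl)
  exact add_one_ne_self hm i (h2.trans h1.symm)

theorem not_univ_subset_singleton (hm : 3 ≤ m) (k : ZMod m) :
    ¬ (Set.univ : Set (ZMod m)) ⊆ {k} := fun h ↦
  not_edge_subset_singleton hm k k ((Set.subset_univ _).trans h)

theorem IsPolygonFace.eq_of_subset_singleton {K : Set (ZMod m)} (h : IsPolygonFace K) {i : ZMod m}
    (hi : K ⊆ {i}) : K = {i} :=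
  (Set.subset_singleton_iff_eq.1 hi).resolve_left h.nonempty.ne_empty

theorem IsPolygonFace.of_subset_edge (hm : 3 ≤ m) {K : Set (ZMod m)} (h : IsPolygonFace K)
    {i : ZMod m} (hi : K ⊆ {i, i + 1}) : (∃ k, K = {k}) ∨ K = {i, i + 1} := by
  cases h with
  | vertex k => exact Or.inl ⟨k, rfl⟩
  | edge k => rw [edge_subset_edge hm hi]; exact Or.inr rfl
  | univ => exact absurd hi (not_univ_subset_edge hm i)

theorem IsPolygonFace.of_singleton_subset {K : Set (ZMod m)} (h : IsPolygonFace K)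
    {i : ZMod m} (hi : {i} ⊆ K) : K = {i} ∨ (∃ k, K = {k, k + 1}) ∨ K = Set.univ := by
  cases h with
  | vertex k => exact Or.inl (by rw [Set.singleton_subset_singleton.1 hi])
  | edge k => exact Or.inr (Or.inl ⟨k, rfl⟩)
  | univ => exact Or.inr (Or.inr rfl)

theorem IsPolygonFace.of_edge_subset (hm : 3 ≤ m) {K : Set (ZMod m)} (h : IsPolygonFace K)
    {i : ZMod m} (hi : {i, i + 1} ⊆ K) : K = {i, i + 1} ∨ K = Set.univ := by
  cases h with
  | vertex k => exact absurd hi (not_edge_subset_singleton hm i k)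
  | edge k => rw [edge_subset_edge hm hi]; exact Or.inl rfl
  | univ => exact Or.inr rfl

theorem setOf_singleton_subset_edge (i : ZMod m) :
    {k : ZMod m | ({i} : Set (ZMod m)) ⊆ {k, k + 1}} = {i - 1, i} := by
  ext k
  rw [Set.mem_ofPred_eq, Set.singleton_subset_iff, mem_edge]
  simp [or_comm]

theorem setOf_edge_subset_edge (hm : 3 ≤ m) (i : ZMod m) :
    {k : ZMod m | ({i, i + 1} : Set (ZMod m)) ⊆ {k, k + 1}} = {i} := by
  ext k
  exact ⟨fun h ↦ edge_subset_edge hm h, fun h ↦ by rw [Set.mem_singleton_iff.1 h]; exact Set.Subset.rfl⟩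

theorem setOf_univ_subset_edge (hm : 3 ≤ m) :
    {k : ZMod m | (Set.univ : Set (ZMod m)) ⊆ {k, k + 1}} = ∅ :=
  Set.eq_empty_of_forall_notMem fun k ↦ not_univ_subset_edge hm k

/-- Every nonempty face of a polygon is the intersection of the edges that contain it. -/
theorem IsPolygonFace.subset_of_edges (hm : 3 ≤ m) {K K' : Set (ZMod m)} (hK : IsPolygonFace K)
    (h : ∀ k : ZMod m, K ⊆ {k, k + 1} → K' ⊆ {k, k + 1}) : K' ⊆ K := by
  cases hK with
  | vertex i =>
    rw [← edge_inter_edge hm i]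
    refine Set.subset_inter ?_ (h i (by simp))
    have := h (i - 1) (by simp)
    rwa [sub_add_cancel] at this
  | edge i => exact h i le_rfl
  | univ => exact Set.subset_univ _

end ZMod

/-! ### The cells of E(C × D) as sets of labels -/

section Product

variable {m n : ℕ}

/-- The index sets of the ridges of a product of two polygons. -/
inductive IsRidgeSet : Set (ZMod m × ZMod n) → Prop
  | vertex_univ (i : ZMod m) : IsRidgeSet ({i} ×ˢ Set.univ)
  | univ_vertex (j : ZMod n) : IsRidgeSet (Set.univ ×ˢ {j})
  | edge_edge (i : ZMod m) (j : ZMod n) : IsRidgeSet ({i, i + 1} ×ˢ {j, j + 1})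

/-- The index sets of the faces of dimension at most one of a product of two polygons. -/
inductive IsLowSet : Set (ZMod m × ZMod n) → Prop
  | empty : IsLowSet ∅
  | vertex_vertex (i : ZMod m) (j : ZMod n) : IsLowSet ({i} ×ˢ {j})
  | edge_vertex (i : ZMod m) (j : ZMod n) : IsLowSet ({i, i + 1} ×ˢ {j})
  | vertex_edge (i : ZMod m) (j : ZMod n) : IsLowSet ({i} ×ˢ {j, j + 1})

/-- The index sets of the faces of a product of two polygons. -/
def IsProductFace (A : Set (ZMod m × ZMod n)) : Prop :=
  A = ∅ ∨ ∃ K L, IsPolygonFace K ∧ IsPolygonFace L ∧ A = K ×ˢ L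

theorem prod_subset_prod_iff' {K K' : Set (ZMod m)} {L L' : Set (ZMod n)} (hK : K.Nonempty)
    (hL : L.Nonempty) : K ×ˢ L ⊆ K' ×ˢ L' ↔ K ⊆ K' ∧ L ⊆ L' := by
  rw [Set.prod_subset_prod_iff]
  simp [hK.ne_empty, hL.ne_empty]

theorem IsRidgeSet.isProductFace {R : Set (ZMod m × ZMod n)} (h : IsRidgeSet R) :
    IsProductFace R := by
  cases h with
  | vertex_univ i => exact Or.inr ⟨_, _, .vertex i, .univ, rfl⟩
  | univ_vertex j => exact Or.inr ⟨_, _, .univ, .vertex j, rfl⟩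
  | edge_edge i j => exact Or.inr ⟨_, _, .edge i, .edge j, rfl⟩

theorem IsLowSet.isProductFace {R : Set (ZMod m × ZMod n)} (h : IsLowSet R) :
    IsProductFace R := by
  cases h with
  | empty => exact Or.inl rfl
  | vertex_vertex i j => exact Or.inr ⟨_, _, .vertex i, .vertex j, rfl⟩
  | edge_vertex i j => exact Or.inr ⟨_, _, .edge i, .vertex j, rfl⟩
  | vertex_edge i j => exact Or.inr ⟨_, _, .vertex i, .edge j, rfl⟩

theorem IsRidgeSet.nonempty {R : Set (ZMod m × ZMod n)} (h : IsRidgeSet R) : R.Nonempty := by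
  cases h with
  | vertex_univ i => exact ⟨(i, 0), by simp⟩
  | univ_vertex j => exact ⟨(0, j), by simp⟩
  | edge_edge i j => exact ⟨(i, j), by simp⟩

theorem isLowSet_of_ssubset (hm : 3 ≤ m) (hn : 3 ≤ n) {G R : Set (ZMod m × ZMod n)}
    (hG : IsProductFace G) (hR : IsRidgeSet R) (h : G ⊂ R) : IsLowSet G := by
  rcases hG with rfl | ⟨K, L, hK, hL, rfl⟩
  · exact .empty
  cases hR with
  | vertex_univ i =>
    obtain rfl := hK.eq_of_subset_singleton
      ((prod_subset_prod_iff' hK.nonempty hL.nonempty).1 h.subset).1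
    cases hL with
    | vertex j => exact .vertex_vertex i j
    | edge j => exact .vertex_edge i j
    | univ => exact absurd rfl h.ne
  | univ_vertex j =>
    obtain rfl := hL.eq_of_subset_singleton
      ((prod_subset_prod_iff' hK.nonempty hL.nonempty).1 h.subset).2
    cases hK with
    | vertex i => exact .vertex_vertex i j
    | edge i => exact .edge_vertex i j
    | univ => exact absurd rfl h.ne
  | edge_edge i j =>
    have hs := (prod_subset_prod_iff' hK.nonempty hL.nonempty).1 h.subset
    rcases hK.of_subset_edge hm hs.1 with ⟨k, rfl⟩ | rfl
    · rcases hL.of_subset_edge hn hs.2 with ⟨l, rfl⟩ | rfl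
      · exact .vertex_vertex k l
      · exact .vertex_edge k j
    · rcases hL.of_subset_edge hn hs.2 with ⟨l, rfl⟩ | rfl
      · exact .edge_vertex i l
      · exact absurd rfl h.ne

theorem eq_of_ridge_ssubset (hm : 3 ≤ m) (hn : 3 ≤ n) {F R : Set (ZMod m × ZMod n)}
    (hF : IsProductFace F) (hR : IsRidgeSet R) (h : R ⊂ F) :
    F = Set.univ ×ˢ Set.univ ∨ (∃ i, F = {i, i + 1} ×ˢ Set.univ) ∨
      ∃ j, F = Set.univ ×ˢ {j, j + 1} := by
  rcases hF with rfl | ⟨K, L, hK, hL, rfl⟩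
  · exact absurd h.subset fun h' ↦ hR.nonempty.ne_empty (Set.subset_empty_iff.1 h')
  cases hR with
  | vertex_univ i =>
    have hs := (prod_subset_prod_iff' (Set.singleton_nonempty i) Set.univ_nonempty).1 h.subset
    obtain rfl := Set.univ_subset_iff.1 hs.2
    rcases hK.of_singleton_subset hs.1 with rfl | ⟨k, rfl⟩ | rfl
    · exact absurd rfl h.ne
    · exact Or.inr (Or.inl ⟨k, rfl⟩)
    · exact Or.inl rfl
  | univ_vertex j =>
    have hs := (prod_subset_prod_iff' Set.univ_nonempty (Set.singleton_nonempty j)).1 h.subset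
    obtain rfl := Set.univ_subset_iff.1 hs.1
    rcases hL.of_singleton_subset hs.2 with rfl | ⟨k, rfl⟩ | rfl
    · exact absurd rfl h.ne
    · exact Or.inr (Or.inr ⟨k, rfl⟩)
    · exact Or.inl rfl
  | edge_edge i j =>
    have hs := (prod_subset_prod_iff' ⟨i, by simp⟩ ⟨j, by simp⟩).1 h.subset
    rcases hK.of_edge_subset hm hs.1 with rfl | rfl
    · rcases hL.of_edge_subset hn hs.2 with rfl | rfl
      · exact absurd rfl h.ne
      · exact Or.inr (Or.inl ⟨i, rfl⟩)
    · rcases hL.of_edge_subset hn hs.2 with rfl | rfl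
      · exact Or.inr (Or.inr ⟨j, rfl⟩)
      · exact Or.inl rfl

theorem prod_ssubset_prod_of_left {K K' : Set (ZMod m)} {L L' : Set (ZMod n)} (hK : K'.Nonempty)
    (hL : L'.Nonempty) (h : K ⊆ K') (h' : ¬ K' ⊆ K) (hL' : L ⊆ L') : K ×ˢ L ⊂ K' ×ˢ L' :=
  ⟨Set.prod_mono h hL', fun hs ↦ h' ((prod_subset_prod_iff' hK hL).1 hs).1⟩

theorem prod_ssubset_prod_of_right {K K' : Set (ZMod m)} {L L' : Set (ZMod n)} (hK : K'.Nonempty)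
    (hL : L'.Nonempty) (h : L ⊆ L') (h' : ¬ L' ⊆ L) (hK' : K ⊆ K') : K ×ˢ L ⊂ K' ×ˢ L' :=
  ⟨Set.prod_mono hK' h, fun hs ↦ h' ((prod_subset_prod_iff' hK hL).1 hs).2⟩

theorem vertex_univ_ssubset (hm : 3 ≤ m) {i k : ZMod m} (h : i ∈ ({k, k + 1} : Set (ZMod m))) :
    ({i} : Set (ZMod m)) ×ˢ (Set.univ : Set (ZMod n)) ⊂ {k, k + 1} ×ˢ Set.univ :=
  prod_ssubset_prod_of_left ⟨k, by simp⟩ Set.univ_nonempty (Set.singleton_subset_iff.2 h)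
    (not_edge_subset_singleton hm k i) le_rfl

theorem univ_vertex_ssubset (hn : 3 ≤ n) {j k : ZMod n} (h : j ∈ ({k, k + 1} : Set (ZMod n))) :
    (Set.univ : Set (ZMod m)) ×ˢ ({j} : Set (ZMod n)) ⊂ Set.univ ×ˢ {k, k + 1} :=
  prod_ssubset_prod_of_right Set.univ_nonempty ⟨k, by simp⟩ (Set.singleton_subset_iff.2 h)
    (not_edge_subset_singleton hn k j) le_rfl

/-- Intervals `[G, F]` are cells only if a ridge lies strictly between their ends. For `G` of
dimension at most one in a facet `F` there always is one, so containment is the only condition that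
is left. -/
theorem IsLowSet.exists_ridge_left (hm : 3 ≤ m) (hn : 3 ≤ n) {G : Set (ZMod m × ZMod n)}
    (hG : IsLowSet G) {k : ZMod m} (h : G ⊆ ({k, k + 1} : Set (ZMod m)) ×ˢ Set.univ) :
    ∃ R, IsRidgeSet R ∧ G ⊂ R ∧ R ⊂ {k, k + 1} ×ˢ Set.univ := by
  cases hG with
  | empty =>
    exact ⟨_, .vertex_univ k, Set.empty_ssubset.2 (IsRidgeSet.vertex_univ k).nonempty,
      vertex_univ_ssubset hm (by simp)⟩
  | vertex_vertex i j =>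
    exact ⟨_, .vertex_univ i, prod_ssubset_prod_of_right (Set.singleton_nonempty i) Set.univ_nonempty (Set.subset_univ _)
      (not_univ_subset_singleton hn j) le_rfl,
      vertex_univ_ssubset hm (by simpa using h (Set.mk_mem_prod rfl rfl))⟩
  | edge_vertex i j =>
    obtain rfl := edge_subset_edge hm
      ((prod_subset_prod_iff' (Set.insert_nonempty _ _) (Set.singleton_nonempty j)).1 h).1
    exact ⟨_, .edge_edge k j, prod_ssubset_prod_of_right ⟨k, by simp⟩ ⟨j, by simp⟩ (by simp)
      (not_edge_subset_singleton hn j j) le_rfl, prod_ssubset_prod_of_right ⟨k, by simp⟩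
      Set.univ_nonempty (Set.subset_univ _) (not_univ_subset_edge hn j) le_rfl⟩
  | vertex_edge i j =>
    exact ⟨_, .vertex_univ i, prod_ssubset_prod_of_right (Set.singleton_nonempty i) Set.univ_nonempty (Set.subset_univ _)
      (not_univ_subset_edge hn j) le_rfl,
      vertex_univ_ssubset hm (h (Set.mk_mem_prod rfl (Set.mem_insert j _))).1⟩

theorem IsLowSet.exists_ridge_right (hm : 3 ≤ m) (hn : 3 ≤ n) {G : Set (ZMod m × ZMod n)}
    (hG : IsLowSet G) {k : ZMod n} (h : G ⊆ Set.univ ×ˢ {k, k + 1}) :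
    ∃ R, IsRidgeSet R ∧ G ⊂ R ∧ R ⊂ Set.univ ×ˢ {k, k + 1} := by
  cases hG with
  | empty =>
    exact ⟨_, .univ_vertex k, Set.empty_ssubset.2 (IsRidgeSet.univ_vertex k).nonempty,
      univ_vertex_ssubset hn (by simp)⟩
  | vertex_vertex i j =>
    exact ⟨_, .univ_vertex j, prod_ssubset_prod_of_left Set.univ_nonempty (Set.singleton_nonempty j) (Set.subset_univ _)
      (not_univ_subset_singleton hm i) le_rfl,
      univ_vertex_ssubset hn (h (Set.mk_mem_prod rfl rfl)).2⟩
  | vertex_edge i j =>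
    obtain rfl := edge_subset_edge hn
      ((prod_subset_prod_iff' (Set.singleton_nonempty i) (Set.insert_nonempty _ _)).1 h).2
    exact ⟨_, .edge_edge i k, prod_ssubset_prod_of_left ⟨i, by simp⟩ ⟨k, by simp⟩ (by simp)
      (not_edge_subset_singleton hm i i) le_rfl, prod_ssubset_prod_of_left Set.univ_nonempty
      ⟨k, by simp⟩ (Set.subset_univ _) (not_univ_subset_edge hm i) le_rfl⟩
  | edge_vertex i j =>
    exact ⟨_, .univ_vertex j, prod_ssubset_prod_of_left Set.univ_nonempty (Set.singleton_nonempty j) (Set.subset_univ _)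
      (not_univ_subset_edge hm i) le_rfl,
      univ_vertex_ssubset hn (h (Set.mk_mem_prod (Set.mem_insert i _) rfl)).2⟩

theorem IsLowSet.exists_ridge (hm : 3 ≤ m) (hn : 3 ≤ n) {G : Set (ZMod m × ZMod n)}
    (hG : IsLowSet G) : ∃ R, IsRidgeSet R ∧ G ⊂ R ∧ R ⊂ Set.univ ×ˢ Set.univ := by
  have h : ∀ k : ZMod m, G ⊆ {k, k + 1} ×ˢ Set.univ →
      ∃ R, IsRidgeSet R ∧ G ⊂ R ∧ R ⊂ Set.univ ×ˢ Set.univ := fun k hk ↦ by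
    obtain ⟨R, h1, h2, h3⟩ := hG.exists_ridge_left hm hn hk
    exact ⟨R, h1, h2, h3.trans_subset (Set.prod_mono (Set.subset_univ _) le_rfl)⟩
  cases hG with
  | empty => exact h 0 (Set.empty_subset _)
  | vertex_vertex i j => exact h i (Set.prod_mono (by simp) (Set.subset_univ _))
  | edge_vertex i j => exact h i (Set.prod_mono le_rfl (Set.subset_univ _))
  | vertex_edge i j => exact h i (Set.prod_mono (by simp) (Set.subset_univ _))

/-- Assemble a set of labels from a set of vertices of the product and sets of facets of the two
kinds. -/
def labels (G : Set (ZMod m × ZMod n)) (A : Set (ZMod m)) (B : Set (ZMod n)) :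
    Set ((ZMod m × ZMod n) ⊕ ZMod m ⊕ ZMod n) :=
  {x | Sum.elim (· ∈ G) (Sum.elim (· ∈ A) (· ∈ B)) x}

/-- The labels of the interval `[G, F]`: the vertices of `G` and the facets above `F`. -/
def intervalLabels (G F : Set (ZMod m × ZMod n)) :
    Set ((ZMod m × ZMod n) ⊕ ZMod m ⊕ ZMod n) :=
  labels G {i | F ⊆ {i, i + 1} ×ˢ Set.univ} {j | F ⊆ Set.univ ×ˢ {j, j + 1}}

/-- The vertex sets of the cells of the sphere `E(C × D)` for two polygons `C` and `D`, where the
vertices are the vertices of `C × D` and the apices over the facets of `C × D`. -/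
inductive IsCellLabels : Set ((ZMod m × ZMod n) ⊕ ZMod m ⊕ ZMod n) → Prop
  | univ : IsCellLabels (labels Set.univ Set.univ Set.univ)
  | vertex_univ (i : ZMod m) : IsCellLabels (labels ({i} ×ˢ Set.univ) {i - 1, i} ∅)
  | univ_vertex (j : ZMod n) : IsCellLabels (labels (Set.univ ×ˢ {j}) ∅ {j - 1, j})
  | edge_edge (i : ZMod m) (j : ZMod n) :
      IsCellLabels (labels ({i, i + 1} ×ˢ {j, j + 1}) {i} {j})
  | low (G : Set (ZMod m × ZMod n)) (hG : IsLowSet G) : IsCellLabels (labels G ∅ ∅)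
  | low_left (G : Set (ZMod m × ZMod n)) (hG : IsLowSet G) (i : ZMod m)
      (hi : G ⊆ {i, i + 1} ×ˢ Set.univ) : IsCellLabels (labels G {i} ∅)
  | low_right (G : Set (ZMod m × ZMod n)) (hG : IsLowSet G) (j : ZMod n)
      (hj : G ⊆ Set.univ ×ˢ {j, j + 1}) : IsCellLabels (labels G ∅ {j})

theorem intervalLabels_prod (G : Set (ZMod m × ZMod n)) {K : Set (ZMod m)} {L : Set (ZMod n)}
    (hK : K.Nonempty) (hL : L.Nonempty) : intervalLabels G (K ×ˢ L) =
      labels G {i | K ⊆ {i, i + 1}} {j | L ⊆ {j, j + 1}} := by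
  simp only [intervalLabels, prod_subset_prod_iff' hK hL, Set.subset_univ, true_and, and_true]

theorem intervalLabels_univ (hm : 3 ≤ m) (hn : 3 ≤ n) (G : Set (ZMod m × ZMod n)) :
    intervalLabels G (Set.univ ×ˢ Set.univ) = labels G ∅ ∅ := by
  rw [intervalLabels_prod G Set.univ_nonempty Set.univ_nonempty, setOf_univ_subset_edge hm,
    setOf_univ_subset_edge hn]

theorem intervalLabels_edge_univ (hm : 3 ≤ m) (hn : 3 ≤ n) (G : Set (ZMod m × ZMod n))
    (i : ZMod m) : intervalLabels G ({i, i + 1} ×ˢ Set.univ) = labels G {i} ∅ := by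
  rw [intervalLabels_prod G ⟨i, by simp⟩ Set.univ_nonempty, setOf_edge_subset_edge hm,
    setOf_univ_subset_edge hn]

theorem intervalLabels_univ_edge (hm : 3 ≤ m) (hn : 3 ≤ n) (G : Set (ZMod m × ZMod n))
    (j : ZMod n) : intervalLabels G (Set.univ ×ˢ {j, j + 1}) = labels G ∅ {j} := by
  rw [intervalLabels_prod G Set.univ_nonempty ⟨j, by simp⟩, setOf_edge_subset_edge hn,
    setOf_univ_subset_edge hm]

/-- Two faces `G`, `F` of a product of polygons that are the ends of a cell. -/
def IsCellInterval (G F : Set (ZMod m × ZMod n)) : Prop :=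
  ∃ R, IsRidgeSet R ∧ (G ⊂ R ∧ R ⊂ F ∨ G = R ∧ R = F)

theorem isCellLabels_iff (hm : 3 ≤ m) (hn : 3 ≤ n)
    (B : Set ((ZMod m × ZMod n) ⊕ ZMod m ⊕ ZMod n)) :
    IsCellLabels B ↔ B = Set.univ ∨ ∃ G F, IsProductFace G ∧ IsProductFace F ∧
      IsCellInterval G F ∧ B = intervalLabels G F := by
  have huniv : labels (Set.univ : Set (ZMod m × ZMod n)) Set.univ Set.univ = Set.univ := by
    ext (x | x | x) <;> simp [labels]
  constructor
  · intro hB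
    cases hB with
    | univ => exact Or.inl huniv
    | vertex_univ i =>
      refine Or.inr ⟨_, _, (IsRidgeSet.vertex_univ i).isProductFace,
        (IsRidgeSet.vertex_univ i).isProductFace, ⟨_, .vertex_univ i, Or.inr ⟨rfl, rfl⟩⟩, ?_⟩
      rw [intervalLabels_prod _ (Set.singleton_nonempty i) Set.univ_nonempty, setOf_univ_subset_edge hn,
        setOf_singleton_subset_edge]
    | univ_vertex j =>
      refine Or.inr ⟨_, _, (IsRidgeSet.univ_vertex j).isProductFace,
        (IsRidgeSet.univ_vertex j).isProductFace, ⟨_, .univ_vertex j, Or.inr ⟨rfl, rfl⟩⟩, ?_⟩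
      rw [intervalLabels_prod _ Set.univ_nonempty (Set.singleton_nonempty j), setOf_univ_subset_edge hm,
        setOf_singleton_subset_edge]
    | edge_edge i j =>
      refine Or.inr ⟨_, _, (IsRidgeSet.edge_edge i j).isProductFace,
        (IsRidgeSet.edge_edge i j).isProductFace, ⟨_, .edge_edge i j, Or.inr ⟨rfl, rfl⟩⟩, ?_⟩
      rw [intervalLabels_prod _ ⟨i, by simp⟩ ⟨j, by simp⟩, setOf_edge_subset_edge hm,
        setOf_edge_subset_edge hn]
    | low G hG =>
      obtain ⟨R, hR, h1, h2⟩ := hG.exists_ridge hm hn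
      exact Or.inr ⟨G, _, hG.isProductFace, Or.inr ⟨_, _, .univ, .univ, rfl⟩,
        ⟨R, hR, Or.inl ⟨h1, h2⟩⟩, (intervalLabels_univ hm hn G).symm⟩
    | low_left G hG i hi =>
      obtain ⟨R, hR, h1, h2⟩ := hG.exists_ridge_left hm hn hi
      exact Or.inr ⟨G, _, hG.isProductFace, Or.inr ⟨_, _, .edge i, .univ, rfl⟩,
        ⟨R, hR, Or.inl ⟨h1, h2⟩⟩, (intervalLabels_edge_univ hm hn G i).symm⟩
    | low_right G hG j hj =>
      obtain ⟨R, hR, h1, h2⟩ := hG.exists_ridge_right hm hn hj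
      exact Or.inr ⟨G, _, hG.isProductFace, Or.inr ⟨_, _, .univ, .edge j, rfl⟩,
        ⟨R, hR, Or.inl ⟨h1, h2⟩⟩, (intervalLabels_univ_edge hm hn G j).symm⟩
  · rintro (rfl | ⟨G, F, hG, hF, ⟨R, hR, ⟨h1, h2⟩ | ⟨rfl, rfl⟩⟩, rfl⟩)
    · rw [← huniv]
      exact .univ
    · have hlow := isLowSet_of_ssubset hm hn hG hR h1
      have hGF := (h1.trans h2).subset
      rcases eq_of_ridge_ssubset hm hn hF hR h2 with rfl | ⟨i, rfl⟩ | ⟨j, rfl⟩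
      · rw [intervalLabels_univ hm hn]
        exact .low G hlow
      · rw [intervalLabels_edge_univ hm hn]
        exact .low_left G hlow i hGF
      · rw [intervalLabels_univ_edge hm hn]
        exact .low_right G hlow j hGF
    · cases hR with
      | vertex_univ i =>
        rw [intervalLabels_prod _ (Set.singleton_nonempty i) Set.univ_nonempty, setOf_univ_subset_edge hn,
          setOf_singleton_subset_edge]
        exact .vertex_univ i
      | univ_vertex j =>
        rw [intervalLabels_prod _ Set.univ_nonempty (Set.singleton_nonempty j), setOf_univ_subset_edge hm,
          setOf_singleton_subset_edge]
        exact .univ_vertex j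
      | edge_edge i j =>
        rw [intervalLabels_prod _ ⟨i, by simp⟩ ⟨j, by simp⟩, setOf_edge_subset_edge hm,
          setOf_edge_subset_edge hn]
        exact .edge_edge i j

/-- The vertex labels determine `G`. The facet labels determine `F`, because every nonempty face is
the intersection of the facets above it. -/
theorem subset_of_intervalLabels_subset (hm : 3 ≤ m) (hn : 3 ≤ n)
    {G F G' F' : Set (ZMod m × ZMod n)} (hF : IsProductFace F) (hF0 : F.Nonempty)
    (hF' : IsProductFace F') (h : intervalLabels G F ⊆ intervalLabels G' F') :
    G ⊆ G' ∧ F' ⊆ F := by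
  refine ⟨fun p hp ↦ h (show Sum.inl p ∈ intervalLabels G F from hp), ?_⟩
  rcases hF' with rfl | ⟨K', L', hK', hL', rfl⟩
  · exact Set.empty_subset _
  rcases hF with rfl | ⟨K, L, hK, hL, rfl⟩
  · exact absurd hF0 Set.not_nonempty_empty
  rw [intervalLabels_prod _ hK.nonempty hL.nonempty,
    intervalLabels_prod _ hK'.nonempty hL'.nonempty] at h
  exact Set.prod_mono
    (hK.subset_of_edges hm fun k hk ↦ h (show Sum.inr (Sum.inl k) ∈ labels G _ _ from hk))
    (hL.subset_of_edges hn fun k hk ↦ h (show Sum.inr (Sum.inr k) ∈ labels G _ _ from hk))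

end Product

/-! ### Embedding the face lattice of the sphere into the sets of labels -/

section Cells

variable {m n : ℕ} {V : Type*} [AddCommGroup V] [Module ℝ V] [TopologicalSpace V] {P : Set V}

/-- The labels of a set of faces: the vertices in all of these faces, and the facets that contain
all of them. -/
def cellLabels (f : Face P ↪o Set (ZMod m × ZMod n)) (A : Set (Face P)) :
    Set ((ZMod m × ZMod n) ⊕ ZMod m ⊕ ZMod n) :=
  {x | ∀ X ∈ A, x ∈ intervalLabels (f X) (f X)}

theorem cellLabels_Icc (f : Face P ↪o Set (ZMod m × ZMod n)) {G F : Face P} (h : G ≤ F) :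
    cellLabels f (Set.Icc G F) = intervalLabels (f G) (f F) := by
  ext (x | x | x)
  · exact ⟨fun hx ↦ hx G ⟨le_rfl, h⟩, fun hx X hX ↦ f.monotone hX.1 hx⟩
  · exact ⟨fun hx ↦ hx F ⟨h, le_rfl⟩, fun hx X hX ↦ (f.monotone hX.2).trans hx⟩
  · exact ⟨fun hx ↦ hx F ⟨h, le_rfl⟩, fun hx X hX ↦ (f.monotone hX.2).trans hx⟩

theorem cellLabels_empty (f : Face P ↪o Set (ZMod m × ZMod n)) :
    cellLabels f (∅ : Set (Face P)) = Set.univ := by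
  ext x
  simp [cellLabels]

/-- A ridge cell `{R}` is the degenerate interval `[R, R]`, so all cells except the empty set are
treated uniformly as intervals. -/
theorem isECell_iff {f : Face P ↪o Set (ZMod m × ZMod n)}
    (hr : ∀ F, IsRidge P F ↔ IsRidgeSet (f F)) (hf : Set.range f = {A | IsProductFace A})
    (A : Set (Face P)) : IsECell P A ↔ A = ∅ ∨ ∃ G F, G ≤ F ∧ IsCellInterval (f G) (f F) ∧
      A = Set.Icc G F := by
  constructor
  · intro h
    cases h with
    | top => exact Or.inl rfl
    | ridge R hR =>
      exact Or.inr ⟨R, R, le_rfl, ⟨_, (hr R).1 hR, Or.inr ⟨rfl, rfl⟩⟩, (Set.Icc_self R).symm⟩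
    | interval G R F hR hGR hRF =>
      exact Or.inr ⟨G, F, (hGR.trans hRF).le,
        ⟨_, (hr R).1 hR, Or.inl ⟨f.lt_iff_lt.2 hGR, f.lt_iff_lt.2 hRF⟩⟩, rfl⟩
  · rintro (rfl | ⟨G, F, -, ⟨R, hR, ⟨h1, h2⟩ | ⟨h1, h2⟩⟩, rfl⟩)
    · exact .top
    · obtain ⟨R, rfl⟩ : R ∈ Set.range f := by rw [hf]; exact hR.isProductFace
      exact .interval G R F ((hr R).2 hR) (f.lt_iff_lt.1 h1) (f.lt_iff_lt.1 h2)
    · obtain rfl : G = F := f.injective (h1.trans h2)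
      rw [Set.Icc_self]
      exact .ridge G ((hr G).2 (h1 ▸ hR))

theorem cellLabels_subset_iff (hm : 3 ≤ m) (hn : 3 ≤ n) {f : Face P ↪o Set (ZMod m × ZMod n)}
    (hr : ∀ F, IsRidge P F ↔ IsRidgeSet (f F)) (hf : Set.range f = {A | IsProductFace A})
    {A B : Set (Face P)} (hA : IsECell P A) (hB : IsECell P B) :
    cellLabels f A ⊆ cellLabels f B ↔ B ⊆ A := by
  refine ⟨fun h ↦ ?_, fun h x hx X hX ↦ hx X (h hX)⟩
  have hface : ∀ F, IsProductFace (f F) := fun F ↦ by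
    have : f F ∈ Set.range f := ⟨F, rfl⟩
    rwa [hf] at this
  rcases (isECell_iff hr hf B).1 hB with rfl | ⟨G', F', hGF', -, rfl⟩
  · exact Set.empty_subset A
  rw [cellLabels_Icc f hGF'] at h
  rcases (isECell_iff hr hf A).1 hA with rfl | ⟨G, F, hGF, ⟨R, hR, hGRF⟩, rfl⟩
  -- No interval carries all labels: `G'` would contain all vertices and yet lie, through `F'`, in a
  -- proper facet.
  · rw [cellLabels_empty, Set.univ_subset_iff] at h
    have h1 : (Set.univ : Set (ZMod m × ZMod n)) ⊆ f G' := fun p _ ↦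
      show Sum.inl p ∈ intervalLabels (f G') (f F') by rw [h]; trivial
    have h2 : f F' ⊆ {(0 : ZMod m), 0 + 1} ×ˢ Set.univ :=
      show Sum.inr (Sum.inl 0) ∈ intervalLabels (f G') (f F') by rw [h]; trivial
    have h3 := (h1.trans (f.monotone hGF')).trans h2
    rw [← Set.univ_prod_univ, prod_subset_prod_iff' Set.univ_nonempty Set.univ_nonempty] at h3
    exact absurd h3.1 (not_univ_subset_edge hm 0)
  · rw [cellLabels_Icc f hGF] at h
    have hF0 : (f F).Nonempty := by
      rcases hGRF with h' | h'
      · exact hR.nonempty.mono h'.2.subset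
      · exact h'.2 ▸ hR.nonempty
    obtain ⟨h1, h2⟩ := subset_of_intervalLabels_subset hm hn (hface F) hF0 (hface F') h
    exact Set.Icc_subset_Icc (f.le_iff_le.1 h1) (f.le_iff_le.1 h2)

/-- The face lattice of `E(P)`, for a polytope `P` with the face lattice of a product of two
polygons, embeds into the sets of labels. -/
theorem exists_cellEmbedding (hm : 3 ≤ m) (hn : 3 ≤ n) {f : Face P ↪o Set (ZMod m × ZMod n)}
    (hr : ∀ F, IsRidge P F ↔ IsRidgeSet (f F)) (hf : Set.range f = {A | IsProductFace A}) :
    ∃ g : ESphere P ↪o Set ((ZMod m × ZMod n) ⊕ ZMod m ⊕ ZMod n),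
      Set.range g = {B | IsCellLabels B} := by
  refine ⟨OrderEmbedding.ofMapLEIff (fun A ↦ cellLabels f (OrderDual.ofDual A).1) fun A B ↦
    cellLabels_subset_iff hm hn hr hf (OrderDual.ofDual A).2 (OrderDual.ofDual B).2, ?_⟩
  ext B
  rw [Set.mem_ofPred_eq, isCellLabels_iff hm hn]
  constructor
  · rintro ⟨A, rfl⟩
    rcases (isECell_iff hr hf _).1 (OrderDual.ofDual A).2 with h | ⟨G, F, hGF, hc, h⟩
    · left
      change cellLabels f (OrderDual.ofDual A).1 = _
      rw [h, cellLabels_empty]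
    · refine Or.inr ⟨f G, f F, ?_, ?_, hc, ?_⟩
      rotate_left 2
      · change cellLabels f (OrderDual.ofDual A).1 = _
        rw [h, cellLabels_Icc f hGF]
      · exact hf.subset ⟨G, rfl⟩
      · exact hf.subset ⟨F, rfl⟩
  · rintro (rfl | ⟨G, F, hG, hF, hc, rfl⟩)
    · exact ⟨OrderDual.toDual ⟨∅, .top⟩, cellLabels_empty f⟩
    · obtain ⟨G, rfl⟩ : G ∈ Set.range f := by rw [hf]; exact hG
      obtain ⟨F, rfl⟩ : F ∈ Set.range f := by rw [hf]; exact hF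
      have hGF : G ≤ F := by
        obtain ⟨R, -, h | h⟩ := hc
        · exact f.le_iff_le.1 (h.1.trans h.2).subset
        · exact f.le_iff_le.1 (h.1.trans h.2).le
      exact ⟨OrderDual.toDual ⟨Set.Icc G F, (isECell_iff hr hf _).2 (Or.inr ⟨G, F, hGF, hc, rfl⟩)⟩,
        cellLabels_Icc f hGF⟩

end Cells

/-! ### Maxima of functionals on the realizing points -/

section Labels

variable {m n : ℕ}

/-- `G` is the part of `K` on which the value `M` is attained, if `c` is the value on `K`. -/
def Attains {ι : Type*} (M c : ℝ) (K G : Set ι) : Prop :=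
  c = M ∧ G = K ∨ c < M ∧ G = ∅

theorem Attains.isSupport {ι : Type*} {M c : ℝ} {K G : Set ι} {f : ι → ℝ} (h : Attains M c K G)
    (hf : IsSupport f c K) : IsSupport f M G := by
  rcases h with ⟨rfl, rfl⟩ | ⟨h, rfl⟩
  · exact hf
  · intro j
    have := (hf j).1
    exact ⟨by linarith, by simp only [Set.mem_empty_iff_false, iff_false]; linarith⟩

/-- A linear functional, evaluated at the vertices of the polytope that belongs to two inscribed
pairs. -/
def labelValue (P : InscribedPair m) (P' : InscribedPair n) (u w : ℝ × ℝ) :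
    (ZMod m × ZMod n) ⊕ ZMod m ⊕ ZMod n → ℝ :=
  Sum.elim (fun p ↦ dot u (P.v p.1) + dot w (P'.v p.2))
    (Sum.elim (fun i ↦ dot u (P.a i)) (fun j ↦ dot w (P'.a j)))

theorem isSupport_labelValue {P : InscribedPair m} {P' : InscribedPair n} {u w : ℝ × ℝ}
    {K A : Set (ZMod m)} {L B : Set (ZMod n)} {c d c' d' M : ℝ}
    (h1 : IsSupport (fun j ↦ dot u (P.v j)) c K) (h2 : IsSupport (fun j ↦ dot u (P.a j)) d A)
    (h3 : IsSupport (fun j ↦ dot w (P'.v j)) c' L) (h4 : IsSupport (fun j ↦ dot w (P'.a j)) d' B)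
    {G : Set (ZMod m × ZMod n)} {A' : Set (ZMod m)} {B' : Set (ZMod n)}
    (hG : Attains M (c + c') (K ×ˢ L) G) (hA : Attains M d A A') (hB : Attains M d' B B') :
    IsSupport (labelValue P P' u w) M (labels G A' B') := by
  have h : IsSupport (fun p : ZMod m × ZMod n ↦ dot u (P.v p.1) + dot w (P'.v p.2))
      (c + c') (K ×ˢ L) := by
    have e1 : IsSupport (fun p : ZMod m × ZMod n ↦ dot u (P.v p.1)) c (Prod.fst ⁻¹' K) :=
      fun p ↦ h1 p.1
    have e2 : IsSupport (fun p : ZMod m × ZMod n ↦ dot w (P'.v p.2)) c' (Prod.snd ⁻¹' L) :=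
      fun p ↦ h3 p.2
    exact e1.add e2
  rintro (x | x | x)
  · exact hG.isSupport h x
  · exact hA.isSupport h2 x
  · exact hB.isSupport h4 x

/-- The eight cases record which of the three maxima reach `M`. All impossible combinations of types
are excluded by linear arithmetic from `c ≤ d ≤ 2 * c` and `c' ≤ d' ≤ 2 * c'`, with the equalities
that the types prescribe. -/
theorem isCellLabels_of_attains {K A A' : Set (ZMod m)} {L B B' : Set (ZMod n)} {c d c' d' M : ℝ}
    (h : SupportType K A c d) (h' : SupportType L B c' d') {G : Set (ZMod m × ZMod n)}
    (hG : Attains M (c + c') (K ×ˢ L) G) (hA : Attains M d A A') (hB : Attains M d' B B')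
    (hM : c + c' = M ∨ d = M ∨ d' = M) : IsCellLabels (labels G A' B') := by
  rcases hG with ⟨e1, rfl⟩ | ⟨e1, rfl⟩ <;> rcases hA with ⟨e2, rfl⟩ | ⟨e2, rfl⟩ <;>
    rcases hB with ⟨e3, rfl⟩ | ⟨e3, rfl⟩
  · cases h <;> cases h' <;> first
      | (exfalso; linarith)
      | exact .edge_edge _ _
      | (rw [Set.univ_prod_univ]; exact .univ)
  · cases h <;> cases h' <;> first
      | (exfalso; linarith)
      | exact .vertex_univ _
      | exact .low_left _ (.vertex_vertex _ _) _ (Set.prod_mono (by simp) (Set.subset_univ _))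
      | exact .low_left _ (.edge_vertex _ _) _ (Set.prod_mono le_rfl (Set.subset_univ _))
      | exact .low_left _ (.vertex_edge _ _) _ (Set.prod_mono (by simp) (Set.subset_univ _))
  · cases h <;> cases h' <;> first
      | (exfalso; linarith)
      | exact .univ_vertex _
      | exact .low_right _ (.vertex_vertex _ _) _ (Set.prod_mono (Set.subset_univ _) (by simp))
      | exact .low_right _ (.edge_vertex _ _) _ (Set.prod_mono (Set.subset_univ _) (by simp))
      | exact .low_right _ (.vertex_edge _ _) _ (Set.prod_mono (Set.subset_univ _) le_rfl)
  · cases h <;> cases h' <;> first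
      | (exfalso; linarith)
      | exact .low _ (.vertex_vertex _ _)
      | exact .low _ (.edge_vertex _ _)
      | exact .low _ (.vertex_edge _ _)
  -- Two apices of different kinds without a product vertex: `d + d' ≤ 2 * (c + c')` contradicts `c
  -- + c' < d = d'`.
  · cases h <;> cases h' <;> exfalso <;> linarith
  · cases h <;> cases h' <;> first
      | (exfalso; linarith)
      | exact .low_left _ .empty _ (Set.empty_subset _)
  · cases h <;> cases h' <;> first
      | (exfalso; linarith)
      | exact .low_right _ .empty _ (Set.empty_subset _)
  · rcases hM with h | h | h <;> linarith

theorem exists_attains {ι : Type*} {M c : ℝ} (K : Set ι) (h : c ≤ M) : ∃ G, Attains M c K G := by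
  rcases h.lt_or_eq with h | h
  · exact ⟨∅, Or.inr ⟨h, rfl⟩⟩
  · exact ⟨K, Or.inl ⟨h, rfl⟩⟩

theorem SupportType.nonempty {K A : Set (ZMod m)} {c d : ℝ} (h : SupportType K A c d) :
    K.Nonempty ∧ A.Nonempty := by
  cases h <;> simp

theorem isCellLabels_argmax (hm : 3 ≤ m) (hn : 3 ≤ n) (P : InscribedPair m) (P' : InscribedPair n)
    (u w : ℝ × ℝ) : IsCellLabels (argmax (labelValue P P' u w)) := by
  obtain ⟨K, A, c, d, h, h1, h2, -⟩ := P.exists_supportType hm u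
  obtain ⟨L, B, c', d', h', h3, h4, -⟩ := P'.exists_supportType hn w
  obtain ⟨M, hM, hM1, hM2, hM3⟩ : ∃ M : ℝ, (c + c' = M ∨ d = M ∨ d' = M) ∧ c + c' ≤ M ∧ d ≤ M ∧
      d' ≤ M := by
    rcases le_total (c + c') d with ha | ha
    · rcases le_total d d' with hb | hb
      · exact ⟨d', by simp, by linarith, by linarith, le_rfl⟩
      · exact ⟨d, by simp, by linarith, le_rfl, by linarith⟩
    · rcases le_total (c + c') d' with hb | hb
      · exact ⟨d', by simp, by linarith, by linarith, le_rfl⟩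
      · exact ⟨c + c', by simp, le_rfl, by linarith, by linarith⟩
  obtain ⟨G, hG⟩ := exists_attains (K ×ˢ L) hM1
  obtain ⟨A', hA⟩ := exists_attains A hM2
  obtain ⟨B', hB⟩ := exists_attains B hM3
  rw [(isSupport_labelValue h1 h2 h3 h4 hG hA hB).argmax_eq]
  · exact isCellLabels_of_attains h h' hG hA hB hM
  · rcases hM with hM | hM | hM
    · obtain rfl : G = K ×ˢ L := by
        rcases hG with h | h
        · exact h.2
        · exact absurd hM h.1.ne
      obtain ⟨p, hp⟩ := h.nonempty.1.prod h'.nonempty.1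
      exact ⟨Sum.inl p, hp⟩
    · obtain rfl : A' = A := by
        rcases hA with h | h
        · exact h.2
        · exact absurd hM h.1.ne
      obtain ⟨p, hp⟩ := h.nonempty.2
      exact ⟨Sum.inr (Sum.inl p), hp⟩
    · obtain rfl : B' = B := by
        rcases hB with h | h
        · exact h.2
        · exact absurd hM h.1.ne
      obtain ⟨p, hp⟩ := h'.nonempty.2
      exact ⟨Sum.inr (Sum.inr p), hp⟩

theorem exists_isSupport_labelValue (P : InscribedPair m) (P' : InscribedPair n)
    {K A A' : Set (ZMod m)} {L B B' : Set (ZMod n)} {c d c' d' : ℝ} (M : ℝ)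
    (h : SupportType K A c d) (h' : SupportType L B c' d') {G : Set (ZMod m × ZMod n)}
    (hG : Attains M (c + c') (K ×ˢ L) G) (hA : Attains M d A A') (hB : Attains M d' B B') :
    ∃ u w, IsSupport (labelValue P P' u w) M (labels G A' B') := by
  obtain ⟨u, h1, h2⟩ := P.exists_functional h
  obtain ⟨w, h3, h4⟩ := P'.exists_functional h'
  exact ⟨u, w, isSupport_labelValue h1 h2 h3 h4 hG hA hB⟩

theorem attains_of_eq {ι : Type*} {M c : ℝ} {K : Set ι} (h : c = M) : Attains M c K K :=
  Or.inl ⟨h, rfl⟩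

theorem attains_of_lt {ι : Type*} {M c : ℝ} {K : Set ι} (h : c < M) : Attains M c K ∅ :=
  Or.inr ⟨h, rfl⟩

/-- For each cell, types and weights are chosen so that exactly the intended maxima among `c + c'`,
`d`, `d'` equal `M` and the others stay below. -/
theorem IsCellLabels.exists_isSupport (hm : 3 ≤ m) (hn : 3 ≤ n) (P : InscribedPair m) (P' : InscribedPair n)
    {B : Set ((ZMod m × ZMod n) ⊕ ZMod m ⊕ ZMod n)} (hB : IsCellLabels B) (hB0 : B.Nonempty) :
    ∃ u w M, IsSupport (labelValue P P' u w) M B := by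
  suffices ∃ M u w, IsSupport (labelValue P P' u w) M B by
    obtain ⟨M, u, w, h⟩ := this
    exact ⟨u, w, M, h⟩
  have key : ∀ {K A A' : Set (ZMod m)} {L B B' : Set (ZMod n)} {c d c' d' : ℝ} (M : ℝ)
    (_ : SupportType K A c d) (_ : SupportType L B c' d') {G : Set (ZMod m × ZMod n)}
    (_ : Attains M (c + c') (K ×ˢ L) G) (_ : Attains M d A A') (_ : Attains M d' B B'),
    ∃ M u w, IsSupport (labelValue P P' u w) M (labels G A' B') :=
    fun M h h' _ hG hA hB ↦ ⟨M, exists_isSupport_labelValue P P' M h h' hG hA hB⟩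
  cases hB with
  | univ =>
    rw [← Set.univ_prod_univ]
    exact key 0 .zero .zero (attains_of_eq (by norm_num)) (attains_of_eq rfl) (attains_of_eq rfl)
  | vertex_univ i =>
    exact key 1 (.outer i 1 (by norm_num)) .zero (attains_of_eq (by norm_num))
      (attains_of_eq rfl) (attains_of_lt (by norm_num))
  | univ_vertex j =>
    exact key 1 .zero (.outer j 1 (by norm_num)) (attains_of_eq (by norm_num))
      (attains_of_lt (by norm_num)) (attains_of_eq rfl)
  | edge_edge i j =>
    exact key 2 (.inner i 1 (by norm_num)) (.inner j 1 (by norm_num))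
      (attains_of_eq (by norm_num)) (attains_of_eq (by norm_num)) (attains_of_eq (by norm_num))
  | low G hG =>
    cases hG with
    | empty =>
      obtain ⟨x | x | x, hx⟩ := hB0 <;> exact absurd hx (Set.notMem_empty x)
    | vertex_vertex i j =>
      exact key 2 (.outer i 1 (by norm_num)) (.outer j 1 (by norm_num))
        (attains_of_eq (by norm_num)) (attains_of_lt (by norm_num)) (attains_of_lt (by norm_num))
    | edge_vertex i j =>
      -- The outer weight 2 lifts `c + c'` to 3, above `d = d' = 2`; with weight 1 the apex over the
      -- edge `i` would also attain the maximum.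
      exact key 3 (.inner i 1 (by norm_num)) (.outer j 2 (by norm_num))
        (attains_of_eq (by norm_num)) (attains_of_lt (by norm_num)) (attains_of_lt (by norm_num))
    | vertex_edge i j =>
      exact key 3 (.outer i 2 (by norm_num)) (.inner j 1 (by norm_num))
        (attains_of_eq (by norm_num)) (attains_of_lt (by norm_num)) (attains_of_lt (by norm_num))
  | low_left G hG k hk =>
    -- A type strictly between outer and inner, with `d = c + 1`: a second functional with `c' = 1`
    -- gives `c + c' = d = 3`, while `d'` is only 1 or 2. Either endpoint of the inner edge that
    -- cuts off `a k` can be the maximiser.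
    have vert : ∀ i ∈ ({k, k + 1} : Set (ZMod m)), SupportType {i} {k} 2 3 := by
      rintro i (rfl | rfl)
      · exact .left i 2 3 (by norm_num) (by norm_num)
      · exact .right k 2 3 (by norm_num) (by norm_num)
    cases hG with
    | empty =>
      exact key 2 (.inner k 1 (by norm_num)) .zero (attains_of_lt (by norm_num))
        (attains_of_eq (by norm_num)) (attains_of_lt (by norm_num))
    | vertex_vertex i j =>
      exact key 3 (vert i (hk (Set.mk_mem_prod rfl rfl)).1) (.outer j 1 (by norm_num))
        (attains_of_eq (by norm_num)) (attains_of_eq rfl) (attains_of_lt (by norm_num))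
    | edge_vertex i j =>
      obtain rfl := edge_subset_edge hm ((prod_subset_prod_iff' (Set.insert_nonempty _ _)
        (Set.singleton_nonempty j)).1 hk).1
      exact key 2 (.inner k 1 (by norm_num)) (.outer j 1 (by norm_num))
        (attains_of_eq (by norm_num)) (attains_of_eq (by norm_num)) (attains_of_lt (by norm_num))
    | vertex_edge i j =>
      exact key 3 (vert i (hk (Set.mk_mem_prod rfl (Set.mem_insert j _))).1)
        (.inner j 1 (by norm_num))
        (attains_of_eq (by norm_num)) (attains_of_eq rfl) (attains_of_lt (by norm_num))
  | low_right G hG k hk =>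
    have vert : ∀ j ∈ ({k, k + 1} : Set (ZMod n)), SupportType {j} {k} 2 3 := by
      rintro j (rfl | rfl)
      · exact .left j 2 3 (by norm_num) (by norm_num)
      · exact .right k 2 3 (by norm_num) (by norm_num)
    cases hG with
    | empty =>
      exact key 2 .zero (.inner k 1 (by norm_num)) (attains_of_lt (by norm_num))
        (attains_of_lt (by norm_num)) (attains_of_eq (by norm_num))
    | vertex_vertex i j =>
      exact key 3 (.outer i 1 (by norm_num)) (vert j (hk (Set.mk_mem_prod rfl rfl)).2)
        (attains_of_eq (by norm_num)) (attains_of_lt (by norm_num)) (attains_of_eq rfl)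
    | edge_vertex i j =>
      exact key 3 (.inner i 1 (by norm_num))
        (vert j (hk (Set.mk_mem_prod (Set.mem_insert i _) rfl)).2)
        (attains_of_eq (by norm_num)) (attains_of_lt (by norm_num)) (attains_of_eq rfl)
    | vertex_edge i j =>
      obtain rfl := edge_subset_edge hn ((prod_subset_prod_iff' (Set.singleton_nonempty i)
        (Set.insert_nonempty _ _)).1 hk).2
      exact key 2 (.outer i 1 (by norm_num)) (.inner k 1 (by norm_num))
        (attains_of_eq (by norm_num)) (attains_of_lt (by norm_num)) (attains_of_eq (by norm_num))

end Labels

/-! ### The polytope in ℝ⁴ -/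

section Realization

variable {m n : ℕ}

theorem SupportType.eq_zero_of_univ (hm : 3 ≤ m) {A : Set (ZMod m)} {c d : ℝ}
    (h : SupportType Set.univ A c d) : c = 0 := by
  generalize hK : (Set.univ : Set (ZMod m)) = K at h
  cases h with
  | zero => rfl
  | outer i c hc => exact absurd hK.subset (not_univ_subset_singleton hm i)
  | inner i c hc => exact absurd hK.subset (not_univ_subset_edge hm i)
  | left i c d hc hd => exact absurd hK.subset (not_univ_subset_singleton hm i)
  | right i c d hc hd => exact absurd hK.subset (not_univ_subset_singleton hm (i + 1))

theorem InscribedPair.eq_zero_of_const (hm : 3 ≤ m) (P : InscribedPair m) {u : ℝ × ℝ}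
    (h : ∀ i j, dot u (P.v i) = dot u (P.v j)) : u = 0 := by
  obtain ⟨K, A, c, d, hT, h1, -, h0⟩ := P.exists_supportType hm u
  obtain rfl : K = Set.univ := by
    rw [← h1.argmax_eq hT.nonempty.1]
    exact Set.eq_univ_of_forall fun i j ↦ (h j i).le
  exact h0 (hT.eq_zero_of_univ hm)

/-- The vertices of the realization of the sphere. -/
def labelPoint (P : InscribedPair m) (P' : InscribedPair n) :
    (ZMod m × ZMod n) ⊕ ZMod m ⊕ ZMod n → EuclideanSpace ℝ (Fin 4) :=
  Sum.elim (fun p ↦ !₂[(P.v p.1).1, (P.v p.1).2, (P'.v p.2).1, (P'.v p.2).2])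
    (Sum.elim (fun i ↦ !₂[(P.a i).1, (P.a i).2, 0, 0])
      (fun j ↦ !₂[0, 0, (P'.a j).1, (P'.a j).2]))

theorem apply_eq_sum_single {k : ℕ} (l : EuclideanSpace ℝ (Fin k) →ₗ[ℝ] ℝ)
    (x : EuclideanSpace ℝ (Fin k)) : l x = ∑ i, x i * l (EuclideanSpace.single i 1) := by
  conv_lhs => rw [← (EuclideanSpace.basisFun (Fin k) ℝ).sum_repr x]
  simp

theorem apply_labelPoint (P : InscribedPair m) (P' : InscribedPair n)
    (l : EuclideanSpace ℝ (Fin 4) →ₗ[ℝ] ℝ) (x : (ZMod m × ZMod n) ⊕ ZMod m ⊕ ZMod n) :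
    l (labelPoint P P' x) = labelValue P P'
      (l (EuclideanSpace.single 0 1), l (EuclideanSpace.single 1 1))
      (l (EuclideanSpace.single 2 1), l (EuclideanSpace.single 3 1)) x := by
  rw [apply_eq_sum_single]
  rcases x with x | x | x <;> simp [labelPoint, labelValue, dot, Fin.sum_univ_four] <;> ring

theorem exists_apply_labelPoint (P : InscribedPair m) (P' : InscribedPair n) (u w : ℝ × ℝ) :
    ∃ l : StrongDual ℝ (EuclideanSpace ℝ (Fin 4)),
      ∀ x, l (labelPoint P P' x) = labelValue P P' u w x := by
  refine ⟨innerSL ℝ !₂[u.1, u.2, w.1, w.2], fun x ↦ ?_⟩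
  rw [← ContinuousLinearMap.coe_coe, apply_labelPoint]
  simp [EuclideanSpace.inner_single_right]

theorem range_vertexEmbedding_labelPoint (hm : 3 ≤ m) (hn : 3 ≤ n) (P : InscribedPair m)
    (P' : InscribedPair n) :
    Set.range (vertexEmbedding (labelPoint P P')) = {B | IsCellLabels B} := by
  rw [range_vertexEmbedding]
  ext B
  constructor
  · rintro (rfl | ⟨-, l, rfl⟩)
    · have : (∅ : Set ((ZMod m × ZMod n) ⊕ ZMod m ⊕ ZMod n)) = labels ∅ ∅ ∅ := by
        ext (x | x | x) <;> simp [labels]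
      rw [this]
      exact .low ∅ .empty
    · have := isCellLabels_argmax hm hn P P'
        (l (EuclideanSpace.single 0 1), l (EuclideanSpace.single 1 1))
        (l (EuclideanSpace.single 2 1), l (EuclideanSpace.single 3 1))
      have h : (fun x ↦ l (labelPoint P P' x)) = _ :=
        funext fun x ↦ apply_labelPoint P P' l.toLinearMap x
      rw [Set.mem_ofPred_eq, h]
      exact this
  · intro hB
    rcases B.eq_empty_or_nonempty with h | h
    · exact Or.inl h
    · obtain ⟨u, w, M, hs⟩ := IsCellLabels.exists_isSupport hm hn P P' hB h
      obtain ⟨l, hl⟩ := exists_apply_labelPoint P P' u w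
      refine Or.inr ⟨h, l, ?_⟩
      rw [funext hl, hs.argmax_eq h]

/-- A proper subspace lies in the kernel of a nonzero functional, which would be constant on the
points. -/
theorem vectorSpan_eq_top {V ι : Type*} [AddCommGroup V] [Module ℝ V] {S : ι → V}
    (h : ∀ l : V →ₗ[ℝ] ℝ, (∀ i j, l (S i) = l (S j)) → l = 0) :
    vectorSpan ℝ (Set.range S) = ⊤ := by
  by_contra hne
  obtain ⟨l, hl0, hl⟩ := Submodule.exists_le_ker_of_lt_top _ (lt_top_iff_ne_top.2 hne)
  refine hl0 (h l fun i j ↦ ?_)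
  have := hl (vsub_mem_vectorSpan ℝ (Set.mem_range_self i) (Set.mem_range_self j))
  rw [LinearMap.mem_ker, vsub_eq_sub, map_sub, sub_eq_zero] at this
  exact this

theorem dim_convexHull {V : Type*} [AddCommGroup V] [Module ℝ V] (s : Set V) :
    dim (convexHull ℝ s) = Module.finrank ℝ (vectorSpan ℝ s) := by
  rw [dim, ← direction_affineSpan, affineSpan_convexHull, direction_affineSpan]

theorem dim_convexHull_labelPoint (hm : 3 ≤ m) (hn : 3 ≤ n) (P : InscribedPair m)
    (P' : InscribedPair n) : dim (convexHull ℝ (Set.range (labelPoint P P'))) = 4 := by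
  rw [dim_convexHull, vectorSpan_eq_top, finrank_top, finrank_euclideanSpace_fin]
  intro l hl
  have h1 : (l (EuclideanSpace.single 0 1), l (EuclideanSpace.single 1 1)) = ((0 : ℝ), (0 : ℝ)) := by
    refine P.eq_zero_of_const hm fun i j ↦ ?_
    have := hl (Sum.inl (i, 0)) (Sum.inl (j, 0))
    rw [apply_labelPoint, apply_labelPoint] at this
    simpa [labelValue] using this
  have h2 : (l (EuclideanSpace.single 2 1), l (EuclideanSpace.single 3 1)) = ((0 : ℝ), (0 : ℝ)) := by
    refine P'.eq_zero_of_const hn fun i j ↦ ?_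
    have := hl (Sum.inl (0, i)) (Sum.inl (0, j))
    rw [apply_labelPoint, apply_labelPoint] at this
    simpa [labelValue] using this
  rw [Prod.mk.injEq] at h1 h2
  ext x
  rw [apply_eq_sum_single]
  simp [Fin.sum_univ_four, h1, h2]

end Realization

/-! ### The face lattice and the ridges of a product of polygons -/

section Polygon

variable {m n : ℕ}

/-- The outer normal is the edge vector turned clockwise by a right angle, since a counterclockwise
polygon lies to the left of its edges. -/
theorem support_edges_of_isLeft {v : ZMod m → EuclideanSpace ℝ (Fin 2)}
    (h : ∀ i j : ZMod m, j ≠ i → j ≠ i + 1 → IsLeft (v i) (v (i + 1)) (v j)) (i : ZMod m) :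
    IsSupport (fun j ↦ dot (v i 1 - v (i - 1) 1, -(v i 0 - v (i - 1) 0)) (v j 0, v j 1))
      (dot (v i 1 - v (i - 1) 1, -(v i 0 - v (i - 1) 0)) (v i 0, v i 1)) {i - 1, i} := by
  intro j
  simp only [Set.mem_insert_iff, Set.mem_singleton_iff]
  by_cases h1 : j = i - 1
  · subst h1
    simp only [true_or, iff_true, dot]
    constructor <;> linarith
  · by_cases h2 : j = i
    · subst h2
      simp
    · have := h (i - 1) j h1 (by rwa [sub_add_cancel])
      rw [sub_add_cancel, IsLeft] at this
      simp only [h1, h2, or_false, iff_false, dot]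
      constructor <;> nlinarith

theorem vectorSpan_polygon (hm : 3 ≤ m) {v : ZMod m → EuclideanSpace ℝ (Fin 2)}
    (h : ∀ i j : ZMod m, j ≠ i → j ≠ i + 1 → IsLeft (v i) (v (i + 1)) (v j)) :
    vectorSpan ℝ (Set.range v) = ⊤ := by
  refine vectorSpan_eq_top fun l hl ↦ ?_
  have h1 := h 0 (0 - 1) (sub_one_ne_self hm 0) (sub_one_ne_add_one hm 0)
  have h2 := hl (0 + 1) 0
  have h3 := hl (0 - 1) 0
  simp only [apply_eq_sum_single l (v _), Fin.sum_univ_two] at h2 h3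
  simp only [IsLeft] at h1
  set p := l (EuclideanSpace.single 0 1) with hp
  set q := l (EuclideanSpace.single 1 1) with hq
  -- Cramer's rule for two edge vectors at the vertex `v 0`; their determinant is the positive
  -- quantity in `IsLeft`.
  have hp0 : p = 0 := by
    refine (mul_eq_zero.1 ?_).resolve_right h1.ne'
    linear_combination (v (0 - 1) 1 - v 0 1) * h2 - (v (0 + 1) 1 - v 0 1) * h3
  have hq0 : q = 0 := by
    refine (mul_eq_zero.1 ?_).resolve_right h1.ne'
    linear_combination (v (0 + 1) 0 - v 0 0) * h3 - (v (0 - 1) 0 - v 0 0) * h2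
  ext x
  rw [apply_eq_sum_single]
  simp [Fin.sum_univ_two, ← hp, ← hq, hp0, hq0]

theorem finrank_vectorSpan_vertex {V : Type*} [AddCommGroup V] [Module ℝ V] (v : ZMod m → V)
    (i : ZMod m) : Module.finrank ℝ (vectorSpan ℝ (v '' {i})) = 0 := by
  rw [Set.image_singleton, vectorSpan_singleton, finrank_bot]

theorem finrank_vectorSpan_edge (hm : 3 ≤ m) {v : ZMod m → EuclideanSpace ℝ (Fin 2)}
    (h : ∀ i j : ZMod m, j ≠ i → j ≠ i + 1 → IsLeft (v i) (v (i + 1)) (v j)) (i : ZMod m) :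
    Module.finrank ℝ (vectorSpan ℝ (v '' {i, i + 1})) = 1 := by
  rw [Set.image_pair, vectorSpan_pair_rev]
  refine finrank_span_singleton ?_
  rw [vsub_eq_sub, sub_ne_zero]
  intro he
  have := h i (i - 1) (sub_one_ne_self hm i) (sub_one_ne_add_one hm i)
  rw [he, IsLeft] at this
  simp at this

theorem finrank_vectorSpan_univ (hm : 3 ≤ m) {v : ZMod m → EuclideanSpace ℝ (Fin 2)}
    (h : ∀ i j : ZMod m, j ≠ i → j ≠ i + 1 → IsLeft (v i) (v (i + 1)) (v j)) :
    Module.finrank ℝ (vectorSpan ℝ (v '' Set.univ)) = 2 := by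
  rw [Set.image_univ, vectorSpan_polygon hm h, finrank_top, finrank_euclideanSpace_fin]

/-- The vertices of a product of two polygons. -/
def prodPoint {V W : Type*} (v : ZMod m → V) (w : ZMod n → W) (p : ZMod m × ZMod n) : V × W :=
  (v p.1, w p.2)

theorem convexHull_range_prodPoint {V W : Type*} [AddCommGroup V] [Module ℝ V] [AddCommGroup W]
    [Module ℝ W] (v : ZMod m → V) (w : ZMod n → W) : convexHull ℝ (Set.range (prodPoint v w)) =
      convexHull ℝ (Set.range v) ×ˢ convexHull ℝ (Set.range w) := by
  rw [← convexHull_prod, Set.range_prodMap.symm]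
  rfl

theorem argmax_add {ι κ : Type*} (f : ι → ℝ) (g : κ → ℝ) :
    argmax (fun p : ι × κ ↦ f p.1 + g p.2) = argmax f ×ˢ argmax g := by
  ext ⟨i, k⟩
  constructor
  · intro h
    exact ⟨fun j ↦ by linarith [h (j, k)], fun j ↦ by linarith [h (i, j)]⟩
  · exact fun h p ↦ add_le_add (h.1 p.1) (h.2 p.2)

variable {v : ZMod m → EuclideanSpace ℝ (Fin 2)} {w : ZMod n → EuclideanSpace ℝ (Fin 2)}

theorem range_vertexEmbedding_prodPoint (hm : 3 ≤ m) (hn : 3 ≤ n)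
    (hv : ∀ i j : ZMod m, j ≠ i → j ≠ i + 1 → IsLeft (v i) (v (i + 1)) (v j))
    (hw : ∀ i j : ZMod n, j ≠ i → j ≠ i + 1 → IsLeft (w i) (w (i + 1)) (w j)) :
    Set.range (vertexEmbedding (prodPoint v w)) = {A | IsProductFace A} := by
  rw [range_vertexEmbedding]
  ext A
  constructor
  · rintro (rfl | ⟨-, l, rfl⟩)
    · exact Or.inl rfl
    · set l₁ : EuclideanSpace ℝ (Fin 2) →ₗ[ℝ] ℝ := l.toLinearMap ∘ₗ LinearMap.inl ℝ _ _
      set l₂ : EuclideanSpace ℝ (Fin 2) →ₗ[ℝ] ℝ := l.toLinearMap ∘ₗ LinearMap.inr ℝ _ _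
      have hl : (fun p ↦ l (prodPoint v w p)) = fun p ↦
          dot (l₁ (EuclideanSpace.single 0 1), l₁ (EuclideanSpace.single 1 1))
            (v p.1 0, v p.1 1) +
          dot (l₂ (EuclideanSpace.single 0 1), l₂ (EuclideanSpace.single 1 1))
            (w p.2 0, w p.2 1) := by
        funext p
        have h1 : l (prodPoint v w p) = l₁ (v p.1) + l₂ (w p.2) := by
          simp [l₁, l₂, prodPoint, ← map_add]
        rw [h1, apply_eq_sum_single l₁, apply_eq_sum_single l₂]
        simp only [Fin.sum_univ_two, dot]
        ring
      rw [hl]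
      exact Or.inr ⟨_, _, isPolygonFace_argmax hm (support_edges_of_isLeft hv) _,
        isPolygonFace_argmax hn (support_edges_of_isLeft hw) _,
        argmax_add (fun i ↦ dot (l₁ (EuclideanSpace.single 0 1), l₁ (EuclideanSpace.single 1 1))
          (v i 0, v i 1)) (fun j ↦ dot (l₂ (EuclideanSpace.single 0 1),
          l₂ (EuclideanSpace.single 1 1)) (w j 0, w j 1))⟩
  · rintro (rfl | ⟨K, L, hK, hL, rfl⟩)
    · exact Or.inl rfl
    · obtain ⟨u, rfl⟩ := exists_argmax_eq hm (support_edges_of_isLeft hv) hK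
      obtain ⟨t, rfl⟩ := exists_argmax_eq hn (support_edges_of_isLeft hw) hL
      refine Or.inr ⟨hK.nonempty.prod hL.nonempty, (innerSL ℝ !₂[u.1, u.2]).coprod
        (innerSL ℝ !₂[t.1, t.2]), ?_⟩
      rw [← argmax_add]
      congr 1
      funext p
      simp [prodPoint, dot, PiLp.inner_apply, Fin.sum_univ_two]
      ring

theorem finrank_prod_submodule {V W : Type*} [AddCommGroup V] [Module ℝ V] [AddCommGroup W]
    [Module ℝ W] [FiniteDimensional ℝ V] [FiniteDimensional ℝ W] (p : Submodule ℝ V)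
    (q : Submodule ℝ W) :
    Module.finrank ℝ (p.prod q) = Module.finrank ℝ p + Module.finrank ℝ q := by
  have h : LinearMap.range (p.subtype.prodMap q.subtype) = p.prod q := by
    rw [LinearMap.range_prodMap, Submodule.range_subtype, Submodule.range_subtype]
  rw [← h, LinearMap.finrank_range_of_inj, Module.finrank_prod]
  exact p.injective_subtype.prodMap q.injective_subtype

theorem dim_face_prodPoint {F : Face (convexHull ℝ (Set.range (prodPoint v w)))}
    {K : Set (ZMod m)} {L : Set (ZMod n)} (hK : K.Nonempty) (hL : L.Nonempty)
    (hF : vertexEmbedding (prodPoint v w) F = K ×ˢ L) :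
    dim (F : Set (EuclideanSpace ℝ (Fin 2) × EuclideanSpace ℝ (Fin 2))) =
      Module.finrank ℝ (vectorSpan ℝ (v '' K)) + Module.finrank ℝ (vectorSpan ℝ (w '' L)) := by
  have h : prodPoint v w '' (K ×ˢ L) = (v '' K) ×ˢ (w '' L) := Set.prodMap_image_prod v w K L
  have h' : {p | prodPoint v w p ∈ (F : Set (EuclideanSpace ℝ (Fin 2) × EuclideanSpace ℝ (Fin 2)))} =
    K ×ˢ L := hF
  rw [face_eq_convexHull, h', h, dim_convexHull,
    vectorSpan_prod_eq (hK.image v) (hL.image w), finrank_prod_submodule]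

theorem isRidge_iff_prodPoint (hm : 3 ≤ m) (hn : 3 ≤ n)
    (hv : ∀ i j : ZMod m, j ≠ i → j ≠ i + 1 → IsLeft (v i) (v (i + 1)) (v j))
    (hw : ∀ i j : ZMod n, j ≠ i → j ≠ i + 1 → IsLeft (w i) (w (i + 1)) (w j))
    (F : Face (convexHull ℝ (Set.range (prodPoint v w)))) :
    IsRidge _ F ↔ IsRidgeSet (vertexEmbedding (prodPoint v w) F) := by
  have hdim : dim (convexHull ℝ (Set.range (prodPoint v w))) = 4 := by
    let F₀ : Face (convexHull ℝ (Set.range (prodPoint v w))) := ⟨_, IsExposed.refl _⟩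
    have h := dim_face_prodPoint (v := v) (w := w) (F := F₀) Set.univ_nonempty Set.univ_nonempty (by
      rw [Set.univ_prod_univ, Set.eq_univ_iff_forall]
      exact fun p ↦ subset_convexHull ℝ _ ⟨p, rfl⟩)
    rw [finrank_vectorSpan_univ hm hv, finrank_vectorSpan_univ hn hw] at h
    exact h
  rw [IsRidge, hdim]
  constructor
  · rintro ⟨hne, hd⟩
    have hF : IsProductFace (vertexEmbedding (prodPoint v w) F) :=
      (range_vertexEmbedding_prodPoint hm hn hv hw).subset ⟨F, rfl⟩
    rcases hF with h | ⟨K, L, hK, hL, h⟩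
    · rw [face_eq_convexHull] at hne
      change (convexHull ℝ (_ '' vertexEmbedding (prodPoint v w) F)).Nonempty at hne
      rw [h] at hne
      simp at hne
    · rw [dim_face_prodPoint hK.nonempty hL.nonempty h] at hd
      rw [h]
      cases hK <;> cases hL <;> simp only [finrank_vectorSpan_vertex,
        finrank_vectorSpan_edge hm hv, finrank_vectorSpan_edge hn hw,
        finrank_vectorSpan_univ hm hv, finrank_vectorSpan_univ hn hw] at hd <;> first
        | omega
        | exact .vertex_univ _
        | exact .univ_vertex _
        | exact .edge_edge _ _
  · intro h
    refine ⟨h.nonempty.elim fun p hp ↦ ⟨_, hp⟩, ?_⟩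
    generalize hA : vertexEmbedding (prodPoint v w) F = A at h
    cases h with
    | vertex_univ i =>
      rw [dim_face_prodPoint (Set.singleton_nonempty i) Set.univ_nonempty hA,
        finrank_vectorSpan_vertex, finrank_vectorSpan_univ hn hw]
    | univ_vertex j =>
      rw [dim_face_prodPoint Set.univ_nonempty (Set.singleton_nonempty j) hA,
        finrank_vectorSpan_vertex, finrank_vectorSpan_univ hm hv]
    | edge_edge i j =>
      rw [dim_face_prodPoint (Set.insert_nonempty _ _) (Set.insert_nonempty _ _) hA,
        finrank_vectorSpan_edge hm hv, finrank_vectorSpan_edge hn hw]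

end Polygon

/-- If there are inscribed pairs, then `E(C × D)` is polytopal for all polygons `C` and `D`. -/
theorem isPolytopal_of_inscribedPair {m n : ℕ} (hm : 3 ≤ m) (hn : 3 ≤ n) (P : InscribedPair m)
    (P' : InscribedPair n) {C D : Set (EuclideanSpace ℝ (Fin 2))} (hC : IsPolygon m C)
    (hD : IsPolygon n D) : IsPolytopal 4 (ESphere (C ×ˢ D)) := by
  have : NeZero m := ⟨by omega⟩
  have : NeZero n := ⟨by omega⟩
  obtain ⟨v, hv, rfl⟩ := hC
  obtain ⟨w, hw, rfl⟩ := hD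
  rw [← convexHull_range_prodPoint]
  obtain ⟨g, hg⟩ := exists_cellEmbedding hm hn (isRidge_iff_prodPoint hm hn hv hw)
    (range_vertexEmbedding_prodPoint hm hn hv hw)
  refine ⟨convexHull ℝ (Set.range (labelPoint P P')), 
    ⟨(Set.finite_range (labelPoint P P')).toFinset, by simp⟩,
    dim_convexHull_labelPoint hm hn P P', ?_⟩
  exact nonempty_orderIso_of_range_eq g (vertexEmbedding (labelPoint P P'))
    (hg.trans (range_vertexEmbedding_labelPoint hm hn P P').symm)

/-! ### Cyclic chains and the decay of functionals along them -/

/-- The second-order recurrence of a closed chain of points `z k` such that `σ • z k` lies on the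
segment between `z (k - 1)` and `z (k + 1)`. -/
def IsRecurrent (σ : ℝ) (d g : ℤ → ℝ) : Prop :=
  ∀ j, g (j + 1) = σ * (1 + d j) * g j - d j * g (j - 1)

section Decay

variable {σ : ℝ} {d g : ℤ → ℝ}

/-- Reading the chain backwards inverts the ratio in which `σ • z j` divides its segment. Decay thus
needs to be proved in one direction only. -/
theorem IsRecurrent.reverse (hg : IsRecurrent σ d g) (hd : ∀ j, 0 < d j) :
    IsRecurrent σ (fun j ↦ (d (-j))⁻¹) (fun j ↦ g (-j)) := by
  intro j
  have h := hg (-j)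
  have hd' := (hd (-j)).ne'
  have e1 : -(j + 1) = -j - 1 := by ring
  have e2 : -(j - 1) = -j + 1 := by ring
  simp only [e1, e2, h]
  field_simp
  ring

/-- The recurrence says that g (j + 1) = σ g j + d j (σ g j - g (j - 1)). If g j ≤ σ g (j - 1) with
positive values, then σ g j ≤ g (j - 1) / 2, so the last term is nonpositive and g (j + 1) ≤ σ g j.
The induction starts with equality, since σ · 2σ = 1. -/
theorem IsRecurrent.lt_one (hσ : 0 < σ) (hσ2 : σ * σ = 1 / 2) (hg : IsRecurrent σ d g)
    (hd : ∀ j, 0 < d j) {k : ℤ} (hk : g k = 2 * σ) (hk1 : g (k + 1) = 1) (n : ℕ)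
    (hpos : ∀ i : ℕ, 1 ≤ i → i ≤ n + 2 → 0 < g (k + i)) : g (k + (n + 2 : ℕ)) < 1 := by
  have hσ1 : σ < 1 := by nlinarith
  have main : ∀ r : ℕ, r ≤ n + 1 → g (k + (r + 1 : ℕ)) ≤ σ * g (k + r) ∧ g (k + (r + 1 : ℕ)) ≤ 1 := by
    intro r
    induction r with
    | zero =>
      intro _
      simp only [zero_add, Nat.cast_one, Nat.cast_zero, add_zero, hk, hk1]
      constructor <;> nlinarith
    | succ r ih =>
      intro hr
      obtain ⟨h1, h2⟩ := ih (by omega)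
      have h3 := hg (k + (r + 1 : ℕ))
      have e1 : k + ((r + 1 : ℕ) : ℤ) + 1 = k + (r + 1 + 1 : ℕ) := by push_cast; ring
      have e2 : k + ((r + 1 : ℕ) : ℤ) - 1 = k + r := by push_cast; ring
      rw [e1, e2] at h3
      have h4 : 0 < g (k + (r + 1 : ℕ)) := hpos _ (by omega) (by omega)
      have h6 : 0 < g (k + r) := by
        by_contra h
        have := mul_nonneg hσ.le (neg_nonneg.2 (not_lt.1 h))
        linarith
      have h5 : σ * g (k + (r + 1 : ℕ)) ≤ g (k + r) := by
        have := mul_le_mul_of_nonneg_left h1 hσ.le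
        rw [← mul_assoc, hσ2] at this
        linarith
      have h7 := mul_le_mul_of_nonneg_left h5 (hd (k + (r + 1 : ℕ))).le
      have h8 : g (k + (r + 1 + 1 : ℕ)) ≤ σ * g (k + (r + 1 : ℕ)) := by rw [h3]; linarith
      exact ⟨h8, h8.trans (by nlinarith)⟩
  have h1 := (main (n + 1) le_rfl).1
  have h2 := (main n (by omega)).2
  nlinarith

end Decay

/-- A cyclic chain of points around the origin, that crosses the axis `x = 0` at the indices `0`
and `m` only. -/
structure IsCyclicChain (σ : ℝ) (m : ℕ) (d x y : ℤ → ℝ) : Prop where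
  pos_d : ∀ j, 0 < d j
  rec_x : IsRecurrent σ d x
  rec_y : IsRecurrent σ d y
  per_x : ∀ j, x (j + 2 * m) = x j
  per_y : ∀ j, y (j + 2 * m) = y j
  pos_x : ∀ j : ℤ, 0 < j → j < m → 0 < x j
  neg_x : ∀ j : ℤ, -m < j → j < 0 → x j < 0
  zero_x : x 0 = 0
  zero_x' : x m = 0
  neg_y : y 0 < 0

namespace IsCyclicChain

variable {σ : ℝ} {m : ℕ} {d x y : ℤ → ℝ}

/-- Each determinant is `d j > 0` times the preceding one, so the sign spreads in both directions
from `j = 0`, where it is that of `-(x 1 * y 0)`. The chain always turns counterclockwise around the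
origin. -/
theorem det_pos (h : IsCyclicChain σ m d x y) (hm : 2 ≤ m) (j : ℤ) :
    0 < x j * y (j + 1) - x (j + 1) * y j := by
  have step : ∀ j, x j * y (j + 1) - x (j + 1) * y j =
      d j * (x (j - 1) * y j - x j * y (j - 1)) := by
    intro j
    rw [h.rec_x j, h.rec_y j]
    ring
  induction j using Int.induction_on with
  | zero =>
    have h1 := h.pos_x 1 one_pos (by exact_mod_cast hm)
    have h2 := h.neg_y
    rw [h.zero_x, zero_add]
    nlinarith
  | succ i ih =>
    rw [step, add_sub_cancel_right]
    exact mul_pos (h.pos_d _) ih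
  | pred i ih =>
    rw [step] at ih
    rw [sub_add_cancel]
    exact pos_of_mul_pos_right ih (h.pos_d _).le

/-- A half-turn exchanges the two halves of the chain; this reduces functionals with `q > 0` to
those with `q < 0`. -/
theorem shift (h : IsCyclicChain σ m d x y) (hm : 2 ≤ m) :
    IsCyclicChain σ m (fun j ↦ d (j + m)) (fun j ↦ -x (j + m)) (fun j ↦ -y (j + m)) := by
  have e : ∀ j : ℤ, j + 1 + m = j + m + 1 := fun j ↦ by ring
  have e' : ∀ j : ℤ, j - 1 + m = j + m - 1 := fun j ↦ by ring
  have hp : ∀ j : ℤ, j + 2 * m + m = j + m + 2 * m := fun j ↦ by ring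
  have hzero : x (0 + m) = 0 := by rw [zero_add, h.zero_x']
  refine ⟨fun j ↦ h.pos_d _, fun j ↦ ?_, fun j ↦ ?_, fun j ↦ ?_, fun j ↦ ?_, fun j h1 h2 ↦ ?_,
    fun j h1 h2 ↦ ?_, ?_, ?_, ?_⟩
  · simp only [e, e', h.rec_x (j + m)]
    ring
  · simp only [e, e', h.rec_y (j + m)]
    ring
  · simp only [hp, h.per_x]
  · simp only [hp, h.per_y]
  · have := h.neg_x (j - m) (by omega) (by omega)
    rw [← h.per_x] at this
    have e3 : j - m + 2 * m = j + m := by ring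
    rw [e3] at this
    linarith
  · have := h.pos_x (j + m) (by omega) (by omega)
    linarith
  · rw [hzero, neg_zero]
  · have := h.per_x 0
    rw [h.zero_x] at this
    have e3 : (m : ℤ) + m = 0 + 2 * m := by ring
    rw [e3, this, neg_zero]
  · have h1 := h.det_pos hm (m - 1)
    have h2 := h.pos_x (m - 1) (by omega) (by omega)
    rw [sub_add_cancel, h.zero_x'] at h1
    rw [zero_add]
    nlinarith

theorem zero_x_neg (h : IsCyclicChain σ m d x y) : x (-m) = 0 := by
  rw [← h.per_x]
  have e : -(m : ℤ) + 2 * m = m := by ring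
  rw [e, h.zero_x']

theorem nonneg_x (h : IsCyclicChain σ m d x y) {j : ℤ} (h1 : 0 ≤ j) (h2 : j ≤ m) : 0 ≤ x j := by
  rcases h1.eq_or_lt with rfl | h1
  · exact h.zero_x.ge
  rcases h2.eq_or_lt with rfl | h2
  · exact h.zero_x'.ge
  exact (h.pos_x j h1 h2).le

theorem nonpos_x (h : IsCyclicChain σ m d x y) {j : ℤ} (h1 : -m ≤ j) (h2 : j ≤ 0) : x j ≤ 0 := by
  rcases h1.eq_or_lt with rfl | h1
  · exact h.zero_x_neg.le
  rcases h2.eq_or_lt with rfl | h2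
  · exact h.zero_x.le
  exact (h.neg_x j h1 h2).le

/-- A functional that is positive at the first point of the chain is positive on an interval of
indices around `0`. -/
theorem pos_of_pos_of_neg (h : IsCyclicChain σ m d x y) (hm : 2 ≤ m) {p q : ℝ} (hq : q < 0)
    {i j l : ℤ} (hi : -m ≤ i) (hij : i ≤ j) (hjl : j ≤ l) (hl : l ≤ m)
    (hgi : 0 < p * x i + q * y i) (hgl : 0 < p * x l + q * y l) : 0 < p * x j + q * y j := by
  -- This expression is `-q` times the determinant of `det_pos`. Where `x ≤ 0`, a step from a
  -- positive to a nonpositive value would make it nonpositive, so positivity spreads from the left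
  -- towards index 0. Where `x ≥ 0` it spreads towards 0 from the right.
  have W : ∀ r, 0 < (p * x r + q * y r) * x (r + 1) - (p * x (r + 1) + q * y (r + 1)) * x r := by
    intro r
    have := mul_pos_of_neg_of_neg hq (neg_neg_of_pos (h.det_pos hm r))
    linarith
  rcases le_total j 0 with hj | hj
  · have main : ∀ r : ℕ, i + r ≤ 0 → 0 < p * x (i + r) + q * y (i + r) := by
      intro r
      induction r with
      | zero => intro _; simpa using hgi
      | succ r ih =>
        intro hr
        push_cast at hr ⊢
        have ih' := ih (by omega)
        have hW := W (i + r)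
        have h1 := h.nonpos_x (j := i + r) (by omega) (by omega)
        have h2 := h.nonpos_x (j := i + r + 1) (by omega) (by omega)
        rw [← add_assoc]
        by_contra hneg
        nlinarith
    have := main (j - i).toNat (by omega)
    rwa [Int.toNat_of_nonneg (by omega), add_sub_cancel] at this
  · have main : ∀ r : ℕ, 0 ≤ l - r → 0 < p * x (l - r) + q * y (l - r) := by
      intro r
      induction r with
      | zero => intro _; simpa using hgl
      | succ r ih =>
        intro hr
        push_cast at hr ⊢
        have ih' := ih (by omega)
        have hW := W (l - (r + 1))
        have h1 := h.nonneg_x (j := l - (r + 1)) (by omega) (by omega)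
        have h2 := h.nonneg_x (j := l - r) (by omega) (by omega)
        have e : l - ((r : ℤ) + 1) + 1 = l - r := by ring
        rw [e] at hW
        by_contra hneg
        nlinarith
    have := main (l - j).toNat (by omega)
    rwa [Int.toNat_of_nonneg (by omega), sub_sub_cancel] at this

/-- Every functional is positive on a cyclic interval of indices. -/
theorem exists_window (h : IsCyclicChain σ m d x y) (hm : 2 ≤ m) (p q : ℝ) :
    ∃ t : ℤ, ∀ i j l : ℤ, t ≤ i → i ≤ j → j ≤ l → l ≤ t + 2 * m → 0 < p * x i + q * y i →
      0 < p * x l + q * y l → 0 < p * x j + q * y j := by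
  rcases lt_trichotomy q 0 with hq | rfl | hq
  · exact ⟨-m, fun i j l h1 h2 h3 h4 h5 h6 ↦
      h.pos_of_pos_of_neg hm hq h1 h2 h3 (by omega) h5 h6⟩
  · simp only [zero_mul, add_zero]
    have hx : ∀ j : ℤ, m ≤ j → j ≤ 2 * m → x j ≤ 0 := by
      intro j h1 h2
      have := h.nonpos_x (j := j - 2 * m) (by omega) (by omega)
      rwa [← h.per_x, sub_add_cancel] at this
    rcases le_or_gt p 0 with hp | hp
    · refine ⟨-m, fun i j l h1 h2 h3 h4 h5 h6 ↦ ?_⟩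
      have key : ∀ i : ℤ, -m ≤ i → i ≤ m → 0 < p * x i → p < 0 ∧ i < 0 ∧ -m < i := by
        intro i h1 h2 h3
        have hxi : x i < 0 := by by_contra hc; nlinarith
        refine ⟨by by_contra hc; nlinarith, ?_, ?_⟩
        · by_contra hc
          linarith [h.nonneg_x (not_lt.1 hc) h2]
        · refine lt_of_le_of_ne h1 fun hc ↦ ?_
          rw [← hc, h.zero_x_neg] at hxi
          exact lt_irrefl _ hxi
      have hi := key i h1 (by omega) h5
      have hl := key l (by omega) (by omega) h6
      exact mul_pos_of_neg_of_neg hi.1 (h.neg_x j (by omega) (by omega))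
    · refine ⟨0, fun i j l h1 h2 h3 h4 h5 h6 ↦ ?_⟩
      have key : ∀ i : ℤ, 0 ≤ i → i ≤ 2 * m → 0 < p * x i → 0 < i ∧ i < m := by
        intro i h1 h2 h3
        have hxi : 0 < x i := pos_of_mul_pos_right h3 hp.le
        constructor
        · refine lt_of_le_of_ne h1 fun hc ↦ ?_
          rw [← hc, h.zero_x] at hxi
          exact lt_irrefl _ hxi
        · by_contra hc
          linarith [hx i (not_lt.1 hc) h2]
      have hi := key i h1 (by omega) h5
      have hl := key l (by omega) (by omega) h6
      exact mul_pos hp (h.pos_x j (by omega) (by omega))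
  · refine ⟨0, fun i j l h1 h2 h3 h4 h5 h6 ↦ ?_⟩
    have := (h.shift hm).pos_of_pos_of_neg hm (p := -p) (q := -q) (neg_neg_of_pos hq)
      (i := i - m) (j := j - m) (l := l - m) (by omega) (by omega) (by omega) (by omega)
    simp only [sub_add_cancel, neg_mul_neg] at this
    exact this h5 h6

theorem rec_functional (h : IsCyclicChain σ m d x y) (p q : ℝ) :
    IsRecurrent σ d (fun j ↦ p * x j + q * y j) := by
  intro j
  simp only [h.rec_x j, h.rec_y j]
  ring

theorem functional_periodic (h : IsCyclicChain σ m d x y) (p q : ℝ) {i j : ℤ}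
    (hij : (2 * m : ℤ) ∣ i - j) : p * x i + q * y i = p * x j + q * y j := by
  have key : ∀ f : ℤ → ℝ, (∀ j, f (j + 2 * m) = f j) → f i = f j := by
    intro f hf
    obtain ⟨c, hc⟩ := hij
    have hp : Function.Periodic f (2 * m : ℤ) := hf
    have := hp.int_mul c j
    rw [show i = j + c * (2 * m : ℤ) by linarith]
    exact this
  rw [key x h.per_x, key y h.per_y]

/-- After `k` and `j` are moved into one window, positivity at both ends gives positivity in
between, and this is what the decay from `k` towards `j` needs. A nonpositive value at `j` is
harmless. -/
theorem lt_one_or (hσ : 0 < σ) (hσ2 : σ * σ = 1 / 2) (h : IsCyclicChain σ m d x y) (hm : 2 ≤ m)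
    {p q : ℝ} {k : ℤ} (h1 : p * x (k + 1) + q * y (k + 1) = 1)
    (h2 : p * x (k - 1) + q * y (k - 1) = 1) (h0 : p * x k + q * y k = 2 * σ) (j : ℤ) :
    p * x j + q * y j < 1 ∨ (2 * m : ℤ) ∣ j - k ∨ (2 * m : ℤ) ∣ j - (k + 1) ∨
      (2 * m : ℤ) ∣ j - (k - 1) := by
  set g : ℤ → ℝ := fun j ↦ p * x j + q * y j with hgdef
  have hg : IsRecurrent σ d g := h.rec_functional p q
  have hper : ∀ i j, (2 * m : ℤ) ∣ i - j → g i = g j := fun i j hij ↦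
    h.functional_periodic p q hij
  change g j < 1 ∨ _
  by_cases hj : g j ≤ 0
  · exact Or.inl (by linarith)
  rw [not_le] at hj
  obtain ⟨t, ht⟩ := h.exists_window hm p q
  have hM : (0 : ℤ) < 2 * m := by omega
  have red : ∀ i : ℤ, ∃ i', t ≤ i' ∧ i' < t + 2 * m ∧ (2 * m : ℤ) ∣ i - i' := fun i ↦
    ⟨t + (i - t) % (2 * m), by linarith [Int.emod_nonneg (i - t) hM.ne'],
      by linarith [Int.emod_lt_of_pos (i - t) hM],
      ⟨(i - t) / (2 * m), by linarith [Int.mul_ediv_add_emod (i - t) (2 * m)]⟩⟩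
  obtain ⟨k', hk1, hk2, hk3⟩ := red k
  obtain ⟨j', hj1, hj2, hj3⟩ := red j
  have ek : g k' = 2 * σ := by rw [← hper k k' hk3]; exact h0
  have ek1 : g (k' + 1) = 1 := by
    rw [← hper (k + 1) (k' + 1) (by simpa using hk3)]; exact h1
  have ek2 : g (k' - 1) = 1 := by
    rw [← hper (k - 1) (k' - 1) (by simpa using hk3)]; exact h2
  have ej : g j = g j' := hper j j' hj3
  have hgk : 0 < g k' := by rw [ek]; positivity
  rw [ej] at hj ⊢
  rcases lt_trichotomy j' k' with hlt | rfl | hlt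
  · by_cases hadj : j' = k' - 1
    · right; right; right
      have : j - (k - 1) = (j - j') - (k - k') := by rw [hadj]; ring
      rw [this]
      exact dvd_sub hj3 hk3
    · left
      have := (hg.reverse h.pos_d).lt_one hσ hσ2 (fun j ↦ inv_pos.2 (h.pos_d _)) (k := -k')
        (by simpa using ek) (by simpa [sub_eq_neg_add, add_comm] using ek2) (k' - j' - 2).toNat ?_
      · simp only [Nat.cast_add, Int.toNat_of_nonneg (show 0 ≤ k' - j' - 2 by omega)] at this
        rwa [show -(-k' + (k' - j' - 2 + (2 : ℕ))) = j' by push_cast; ring] at this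
      · intro i hi1 hi2
        have := ht j' (k' - i) k' hj1 (by omega) (by omega) hk2.le hj hgk
        rwa [show -(-k' + (i : ℤ)) = k' - i by ring]
  · right; left
    have : j - k = (j - j') - (k - j') := by ring
    rw [this]
    exact dvd_sub hj3 hk3
  · by_cases hadj : j' = k' + 1
    · right; right; left
      have : j - (k + 1) = (j - j') - (k - k') := by rw [hadj]; ring
      rw [this]
      exact dvd_sub hj3 hk3
    · left
      have := hg.lt_one hσ hσ2 h.pos_d (k := k') ek ek1 (j' - k' - 2).toNat ?_
      · simp only [Nat.cast_add, Int.toNat_of_nonneg (show 0 ≤ j' - k' - 2 by omega)] at this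
        rwa [show k' + (j' - k' - 2 + (2 : ℕ)) = j' by push_cast; ring] at this
      · intro i hi1 hi2
        exact ht k' (k' + i) j' hk1 (by omega) (by omega) hj2.le hgk hj

/-- The line through the two neighbours of a point of the chain. -/
theorem exists_functional (hσ : 0 < σ) (hσ2 : σ * σ = 1 / 2) (h : IsCyclicChain σ m d x y)
    (hm : 2 ≤ m) (k : ℤ) : ∃ u : ℝ × ℝ, dot u (x (k + 1), y (k + 1)) = 1 ∧
      dot u (x (k - 1), y (k - 1)) = 1 ∧ dot u (x k, y k) = 2 * σ := by
  have hdet : 0 < x (k - 1) * y (k + 1) - x (k + 1) * y (k - 1) := by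
    have h1 := h.det_pos hm (k - 1)
    rw [sub_add_cancel] at h1
    have h2 := h.pos_d k
    have : x (k - 1) * y (k + 1) - x (k + 1) * y (k - 1) =
        σ * (1 + d k) * (x (k - 1) * y k - x k * y (k - 1)) := by
      rw [h.rec_x k, h.rec_y k]; ring
    rw [this]
    positivity
  set D := x (k - 1) * y (k + 1) - x (k + 1) * y (k - 1) with hD
  refine ⟨((y (k + 1) - y (k - 1)) / D, (x (k - 1) - x (k + 1)) / D), ?_, ?_, ?_⟩
  · simp only [dot]
    field_simp
    rw [hD]; ring
  · simp only [dot]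
    field_simp
    rw [hD]; ring
  -- The line through the neighbours contains `σ` times the point `k`, so the value there is 1/σ =
  -- 2σ.
  · have h1 : (y (k + 1) - y (k - 1)) * x k + (x (k - 1) - x (k + 1)) * y k = 2 * σ * D := by
      have e1 := h.rec_x k
      have e2 := h.rec_y k
      have h2 := h.pos_d k
      have : (1 + d k) * ((y (k + 1) - y (k - 1)) * x k + (x (k - 1) - x (k + 1)) * y k) =
          (1 + d k) * (2 * σ * D) := by
        rw [hD, e1, e2]
        linear_combination (-2 * (1 + d k) * (1 + d k) *
          (x (k - 1) * y k - x k * y (k - 1))) * hσ2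
      exact mul_left_cancel₀ (by positivity) this
    simp only [dot]
    field_simp
    linarith

end IsCyclicChain

/-! ### Unfolding half of a mirror-symmetric chain -/

section Unfold

/-- Half of a mirror-symmetric cyclic chain. -/
structure IsHalfChain (σ : ℝ) (m : ℕ) (d x y : ℕ → ℝ) : Prop where
  pos_d : ∀ k, 0 < k → k < m → 0 < d k
  rec_x : ∀ k, k + 1 < m → x (k + 2) = σ * (1 + d (k + 1)) * x (k + 1) - d (k + 1) * x k
  rec_y : ∀ k, k + 1 < m → y (k + 2) = σ * (1 + d (k + 1)) * y (k + 1) - d (k + 1) * y k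
  pos_x : ∀ k, 0 < k → k < m → 0 < x k
  zero_x : x 0 = 0
  zero_x' : x m = 0
  neg_y : y 0 < 0
  start_y : y 1 = σ * y 0
  end_y : y (m - 1) = σ * y m

/-- Extend two sequences on `0, …, m` periodically, with the second one on the reversed second
half of the period. -/
noncomputable def unfold (m : ℕ) (f f' : ℕ → ℝ) (j : ℤ) : ℝ :=
  if j % (2 * m) ≤ m then f (j % (2 * m)).toNat else f' (2 * m - j % (2 * m)).toNat

variable {σ : ℝ} {m : ℕ} {f f' : ℕ → ℝ}

theorem unfold_periodic (j : ℤ) : unfold m f f' (j + 2 * m) = unfold m f f' j := by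
  simp only [unfold, Int.add_emod_right]

theorem unfold_natCast {r : ℕ} (hm : 0 < m) (hr : r ≤ m) : unfold m f f' r = f r := by
  have : (r : ℤ) % (2 * m) = r := Int.emod_eq_of_lt (by omega) (by omega)
  rw [unfold, this, if_pos (by exact_mod_cast hr), Int.toNat_natCast]

theorem unfold_neg_natCast {r : ℕ} (h0 : 0 < r) (hr : r < m) : unfold m f f' (-r) = f' r := by
  have : (-r : ℤ) % (2 * m) = 2 * m - r := by
    rw [← Int.add_emod_right]
    exact (Int.emod_eq_of_lt (by omega) (by omega)).trans (by ring)
  rw [unfold, this, if_neg (by omega), sub_sub_cancel, Int.toNat_natCast]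

theorem exists_eq_add (hm : 0 < m) (j : ℤ) : ∃ (r : ℕ) (c : ℤ), r ≤ m ∧
    (j = r + c * (2 * m) ∨ (0 < r ∧ r < m ∧ j = -r + c * (2 * m))) := by
  have hM : (0 : ℤ) < 2 * m := by omega
  have h1 := Int.emod_nonneg j hM.ne'
  have h2 := Int.emod_lt_of_pos j hM
  have h3 := Int.emod_add_mul_ediv j (2 * m)
  by_cases h : j % (2 * m) ≤ m
  · refine ⟨(j % (2 * m)).toNat, j / (2 * m), by omega, Or.inl ?_⟩
    rw [Int.toNat_of_nonneg h1]
    linarith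
  · refine ⟨(2 * m - j % (2 * m)).toNat, j / (2 * m) + 1, by omega, Or.inr ⟨by omega, by omega, ?_⟩⟩
    rw [Int.toNat_of_nonneg (by omega)]
    linarith

/-- `ε` is the parity under the mirror: -1 for `x` and 1 for `y`. At the two fixed indices 0 and `m`
the parameter is 1 by symmetry, and the recurrence there becomes the hypotheses with `1 + ε`. On the
mirrored half the parameters are inverted. -/
theorem isRecurrent_unfold {d : ℕ → ℝ} {ε : ℝ} (hm : 2 ≤ m) (hd : ∀ k, 0 < k → k < m → 0 < d k)
    (hrec : ∀ k, k + 1 < m → f (k + 2) = σ * (1 + d (k + 1)) * f (k + 1) - d (k + 1) * f k)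
    (h0 : (1 + ε) * f 1 = 2 * σ * f 0) (h0' : ε * f 0 = f 0)
    (hm1 : (1 + ε) * f (m - 1) = 2 * σ * f m) (hm' : ε * f m = f m) :
    IsRecurrent σ (unfold m (fun k ↦ if k = 0 ∨ k = m then 1 else d k) (fun k ↦ (d k)⁻¹))
      (unfold m f (fun k ↦ ε * f k)) := by
  intro j
  have per : ∀ (g g' : ℕ → ℝ) (a c : ℤ), unfold m g g' (a + c * (2 * m)) = unfold m g g' a :=
    fun g g' a c ↦ (show Function.Periodic (unfold m g g') (2 * m : ℤ) from
      unfold_periodic).int_mul c a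
  have neg : ∀ r : ℕ, r ≤ m → unfold m f (fun k ↦ ε * f k) (-r) = ε * f r := by
    intro r hr
    rcases r.eq_zero_or_pos with rfl | h
    · have := unfold_natCast (m := m) (f := f) (f' := fun k ↦ ε * f k) (r := 0) (by omega) (by omega)
      simpa [h0'] using this
    rcases hr.eq_or_lt with rfl | hr
    · rw [← unfold_periodic, show -(r : ℤ) + 2 * r = r by ring, unfold_natCast h le_rfl, hm']
    · exact unfold_neg_natCast h hr
  obtain ⟨r, c, hr, rfl | ⟨hr0, hrm, rfl⟩⟩ := exists_eq_add (m := m) (by omega) j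
  · rw [show (r + c * (2 * m) + 1 : ℤ) = (r + 1 : ℤ) + c * (2 * m) by ring,
      show (r + c * (2 * m) - 1 : ℤ) = (r - 1 : ℤ) + c * (2 * m) by ring]
    simp only [per]
    rw [unfold_natCast (by omega) hr, unfold_natCast (by omega) hr]
    rcases r.eq_zero_or_pos with rfl | h
    · have e1 := unfold_natCast (m := m) (f := f) (f' := fun k ↦ ε * f k) (r := 1) (by omega)
        (by omega)
      have e2 := neg 1 (by omega)
      simp only [Nat.cast_one, Nat.cast_zero, zero_add, zero_sub, true_or, if_true] at e1 e2 ⊢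
      rw [e1, e2]
      linarith
    rcases hr.eq_or_lt with rfl | hr
    · have e1 := neg (r - 1) (by omega)
      rw [← unfold_periodic] at e1
      have e2 := unfold_natCast (m := r) (f := f) (f' := fun k ↦ ε * f k) (r := r - 1) h (by omega)
      push_cast [Nat.cast_sub (show 1 ≤ r by omega)] at e1 e2
      rw [show -((r : ℤ) - 1) + 2 * r = r + 1 by ring] at e1
      simp only [or_true, if_true]
      rw [e1, e2]
      linarith
    · obtain ⟨s, rfl⟩ := Nat.exists_eq_succ_of_ne_zero h.ne'
      have e1 := unfold_natCast (m := m) (f := f) (f' := fun k ↦ ε * f k) (r := s + 2) (by omega)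
        (by omega)
      have e2 := unfold_natCast (m := m) (f := f) (f' := fun k ↦ ε * f k) (r := s) (by omega)
        (by omega)
      push_cast at e1 ⊢
      rw [show (s : ℤ) + 1 + 1 = s + 2 by ring, add_sub_cancel_right, e1, e2,
        if_neg (by simpa using hr.ne)]
      exact hrec s hr
  · obtain ⟨s, rfl⟩ := Nat.exists_eq_succ_of_ne_zero hr0.ne'
    have e1 := neg s (by omega)
    have e2 := neg (s + 2) (by omega)
    rw [show (-((s.succ : ℕ) : ℤ) + c * (2 * m) + 1 : ℤ) = -s + c * (2 * m) by push_cast; ring,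
      show (-((s.succ : ℕ) : ℤ) + c * (2 * m) - 1 : ℤ) = -(s + 2 : ℕ) + c * (2 * m) by
        push_cast; ring]
    simp only [per]
    rw [e1, e2, neg _ hr, unfold_neg_natCast hr0 hrm]
    have h := hrec s hrm
    have hds := (hd (s + 1) hr0 hrm).ne'
    simp only [Nat.succ_eq_add_one] at *
    rw [h]
    field_simp
    ring

theorem IsHalfChain.isCyclicChain {d x y : ℕ → ℝ} (hm : 2 ≤ m) (h : IsHalfChain σ m d x y) :
    ∃ d' x' y' : ℤ → ℝ, IsCyclicChain σ m d' x' y' := by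
  refine ⟨unfold m (fun k ↦ if k = 0 ∨ k = m then 1 else d k) (fun k ↦ (d k)⁻¹),
    unfold m x (fun k ↦ -1 * x k), unfold m y (fun k ↦ 1 * y k), ?_, ?_, ?_,
    fun _ ↦ unfold_periodic _, fun _ ↦ unfold_periodic _, ?_, ?_, ?_, ?_, ?_⟩
  · intro j
    have h1 : 0 ≤ j % (2 * m) := Int.emod_nonneg j (by omega)
    have h2 : j % (2 * m) < 2 * m := Int.emod_lt_of_pos j (by omega)
    rw [unfold]
    split_ifs with h3 h4
    · exact one_pos
    · exact h.pos_d _ (by omega) (by omega)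
    · exact inv_pos.2 (h.pos_d _ (by omega) (by omega))
  · exact isRecurrent_unfold hm h.pos_d h.rec_x (by rw [h.zero_x]; ring) (by rw [h.zero_x]; ring)
      (by rw [h.zero_x']; ring) (by rw [h.zero_x']; ring)
  · exact isRecurrent_unfold hm h.pos_d h.rec_y (by rw [h.start_y]; ring) (by ring)
      (by rw [h.end_y]; ring) (by ring)
  · intro j h1 h2
    lift j to ℕ using h1.le
    rw [unfold_natCast (by omega) (by omega)]
    exact h.pos_x j (by omega) (by omega)
  · intro j h1 h2
    obtain ⟨r, rfl⟩ : ∃ r : ℕ, j = -r := ⟨(-j).toNat, by omega⟩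
    rw [unfold_neg_natCast (by omega) (by omega)]
    linarith [h.pos_x r (by omega) (by omega)]
  · have := unfold_natCast (m := m) (f := x) (f' := fun k ↦ -1 * x k) (r := 0) (by omega) (by omega)
    rw [Nat.cast_zero] at this
    rw [this, h.zero_x]
  · rw [unfold_natCast (by omega) le_rfl, h.zero_x']
  · have := unfold_natCast (m := m) (f := y) (f' := fun k ↦ 1 * y k) (r := 0) (by omega) (by omega)
    rw [Nat.cast_zero] at this
    rw [this]
    exact h.neg_y

end Unfold

/-! ### Growing and closing a half chain -/

section HalfChain

/-- Solutions of the recurrence with the constant parameter `7`. -/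
noncomputable def growth (σ a b : ℝ) : ℕ → ℝ
  | 0 => a
  | 1 => b
  | k + 2 => σ * (1 + 7) * growth σ a b (k + 1) - 7 * growth σ a b k

/-- The characteristic roots 2√2 ± 1 for the parameter 7 and σ = 1/√2 are real, so solutions grow
instead of rotating, and arbitrarily many points fit into a half-turn. The ratio 3 persists because
8σ - 7/3 ≥ 3. -/
theorem growth_le {σ a b : ℝ} (hσ : 7 / 10 ≤ σ) {k : ℕ} (hk : 0 ≤ growth σ a b k)
    (h : 3 * growth σ a b k ≤ growth σ a b (k + 1)) (r : ℕ) :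
    0 ≤ growth σ a b (k + r) ∧ 3 * growth σ a b (k + r) ≤ growth σ a b (k + r + 1) := by
  induction r with
  | zero => exact ⟨hk, h⟩
  | succ r ih =>
    obtain ⟨h1, h2⟩ := ih
    refine ⟨by rw [← add_assoc]; linarith, ?_⟩
    have : growth σ a b (k + r + 2) =
      σ * (1 + 7) * growth σ a b (k + r + 1) - 7 * growth σ a b (k + r) := rfl
    rw [← add_assoc, this]
    nlinarith

theorem growth_det {σ a b a' b' : ℝ} (h : 0 < a * b' - b * a') (k : ℕ) :
    0 < growth σ a b k * growth σ a' b' (k + 1) - growth σ a b (k + 1) * growth σ a' b' k := by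
  induction k with
  | zero => exact h
  | succ k ih =>
    have h1 : growth σ a b (k + 2) =
      σ * (1 + 7) * growth σ a b (k + 1) - 7 * growth σ a b k := rfl
    have h2 : growth σ a' b' (k + 2) =
      σ * (1 + 7) * growth σ a' b' (k + 1) - 7 * growth σ a' b' k := rfl
    rw [h1, h2]
    nlinarith

theorem exists_isHalfChain {σ : ℝ} (hσ : 0 < σ) (hσ2 : σ * σ = 1 / 2) (k : ℕ) :
    ∃ d x y, IsHalfChain σ (k + 4) d x y := by
  have hσ7 : 7 / 10 ≤ σ := by nlinarith
  set X := growth σ 0 1 with hX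
  set Y := growth σ (-1) (-σ) with hY
  have recX : ∀ r, X (r + 2) = σ * (1 + 7) * X (r + 1) - 7 * X r := fun r ↦ rfl
  have recY : ∀ r, Y (r + 2) = σ * (1 + 7) * Y (r + 1) - 7 * Y r := fun r ↦ rfl
  have X0 : X 0 = 0 := rfl
  have X1 : X 1 = 1 := rfl
  have Y0 : Y 0 = -1 := rfl
  have Y1 : Y 1 = -σ := rfl
  have Y2 : Y 2 = 3 := by rw [recY 0, zero_add, Y1, Y0]; linarith
  have Y3 : 3 * Y 2 ≤ Y 3 := by rw [recY 1, Y2, Y1]; linarith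
  have gX : ∀ r, 0 ≤ X r ∧ 3 * X r ≤ X (r + 1) := fun r ↦ by
    have := growth_le (σ := σ) (a := 0) (b := 1) (k := 0) hσ7 le_rfl (by simp [growth]) r
    rwa [zero_add] at this
  have gY : ∀ r, 0 ≤ Y (r + 2) ∧ 3 * Y (r + 2) ≤ Y (r + 3) := fun r ↦ by
    have := growth_le (σ := σ) (k := 2) hσ7 (by rw [← hY, Y2]; norm_num) Y3 r
    rwa [add_comm 2 r] at this
  have posX : ∀ r, 0 < X (r + 1) := by
    intro r
    induction r with
    | zero => rw [zero_add, X1]; norm_num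
    | succ r ih => linarith [(gX (r + 1)).2]
  have posY : ∀ r, 0 < Y (r + 2) := by
    intro r
    induction r with
    | zero => rw [zero_add, Y2]; norm_num
    | succ r ih => linarith [(gY r).2]
  have hdet : 0 < X (k + 1) * Y (k + 2) - X (k + 2) * Y (k + 1) :=
    growth_det (by norm_num) (k + 1)
  obtain ⟨p, hp⟩ : ∃ p, p = X (k + 2) := ⟨_, rfl⟩
  obtain ⟨p', hp'⟩ : ∃ p', p' = X (k + 1) := ⟨_, rfl⟩
  obtain ⟨q, hq⟩ : ∃ q, q = Y (k + 2) := ⟨_, rfl⟩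
  obtain ⟨q', hq'⟩ : ∃ q', q' = Y (k + 1) := ⟨_, rfl⟩
  have p0 : 0 < p := hp ▸ posX (k + 1)
  have p0' : 0 < p' := hp' ▸ posX k
  have q0 : 0 < q := hq ▸ posY k
  have hpp : 3 * p' ≤ p := by rw [hp, hp']; exact (gX (k + 1)).2
  rw [← hp, ← hp', ← hq, ← hq'] at hdet
  have hP : 0 < σ * p - p' := by nlinarith
  have hQ : 0 < σ * q - q' := by
    have h1 : p * q' < p' * q := by linarith
    have h2 : p' * q < σ * p * q := by nlinarith
    by_contra hc
    nlinarith
  -- The recurrences of `x` and of `y` at index `k + 2` each determine the parameter there; the two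
  -- values agree exactly if `E * E = t`. The determinant of the last two grown points gives `t <
  -- 1`.
  obtain ⟨t, ht⟩ : ∃ t, t = (σ * p - p') * q / ((σ * q - q') * p) := ⟨_, rfl⟩
  have ht0 : 0 < t := by rw [ht]; positivity
  have ht1 : t < 1 := by
    rw [ht, div_lt_one (by positivity)]
    nlinarith
  obtain ⟨E, hE⟩ : ∃ E, E = √t := ⟨_, rfl⟩
  have hE0 : 0 < E := by rw [hE]; exact Real.sqrt_pos.2 ht0
  have hE1 : E < 1 := by
    rw [hE]; exact (Real.sqrt_lt_sqrt ht0.le ht1).trans_eq Real.sqrt_one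
  have hEE : E * E * ((σ * q - q') * p) = (σ * p - p') * q := by
    rw [hE, Real.mul_self_sqrt ht0.le, ht, div_mul_cancel₀ _ (by positivity)]
  have hE1' : 0 < 1 - E := by linarith
  -- The final point lies on the axis and the one before it has height `σ` times the final height,
  -- as the mirror symmetry demands. The last parameter comes from the recurrence of `x` with final
  -- value 0, and is positive because `E < 1`.
  refine ⟨fun r ↦ if r ≤ k + 1 then 7 else if r = k + 2 then E * σ * p / (σ * p - p') else
      (1 + E) / (1 - E),
    fun r ↦ if r ≤ k + 2 then X r else if r = k + 3 then σ * p * (1 + E) else 0,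
    fun r ↦ if r ≤ k + 2 then Y r else if r = k + 3 then σ * q * (1 + E) / E else
      q * (1 + E) / E, ?_, ?_, ?_, ?_, ?_, ?_, ?_, ?_, ?_⟩
  · intro r _ _
    split_ifs
    · norm_num
    · positivity
    · positivity
  · intro r hr
    rcases lt_trichotomy r (k + 1) with h | rfl | h
    · simp only [show r + 2 ≤ k + 2 by omega, show r + 1 ≤ k + 1 by omega,
        show r + 1 ≤ k + 2 by omega, show r ≤ k + 2 by omega, if_true]
      exact recX r
    · simp only [show ¬ k + 1 + 2 ≤ k + 2 by omega, show k + 1 + 2 = k + 3 by omega,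
        show k + 1 ≤ k + 2 by omega,
        show ¬ k + 1 + 1 ≤ k + 1 by omega, show k + 1 + 1 = k + 2 by omega, le_refl, if_true, if_false,
        ← hp, ← hp']
      field_simp
      ring
    · obtain rfl : r = k + 2 := by omega
      simp only [show ¬ k + 2 + 2 ≤ k + 2 by omega, show ¬ k + 2 + 2 = k + 3 by omega,
        show ¬ k + 2 + 1 ≤ k + 2 by omega, show k + 2 + 1 = k + 3 by omega,
        show ¬ k + 3 ≤ k + 1 by omega, show ¬ k + 3 = k + 2 by omega, le_refl, if_true, if_false,
        ← hp]
      field_simp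
      linear_combination (-2 * (1 + E) * p) * hσ2
  · intro r hr
    rcases lt_trichotomy r (k + 1) with h | rfl | h
    · simp only [show r + 2 ≤ k + 2 by omega, show r + 1 ≤ k + 1 by omega,
        show r + 1 ≤ k + 2 by omega, show r ≤ k + 2 by omega, if_true]
      exact recY r
    · simp only [show ¬ k + 1 + 2 ≤ k + 2 by omega, show k + 1 + 2 = k + 3 by omega,
        show k + 1 ≤ k + 2 by omega,
        show ¬ k + 1 + 1 ≤ k + 1 by omega, show k + 1 + 1 = k + 2 by omega, le_refl, if_true, if_false,
        ← hq, ← hq']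
      field_simp
      linear_combination -hEE
    · obtain rfl : r = k + 2 := by omega
      simp only [show ¬ k + 2 + 2 ≤ k + 2 by omega, show ¬ k + 2 + 2 = k + 3 by omega,
        show ¬ k + 2 + 1 ≤ k + 2 by omega, show k + 2 + 1 = k + 3 by omega,
        show ¬ k + 3 ≤ k + 1 by omega, show ¬ k + 3 = k + 2 by omega, le_refl, if_true, if_false,
        ← hq]
      field_simp
      linear_combination (-2 : ℝ) * hσ2
  · intro r h0 h
    obtain ⟨s, rfl⟩ := Nat.exists_eq_succ_of_ne_zero h0.ne'
    split_ifs with h1 h2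
    · exact posX s
    · positivity
    · omega
  · simp [X0]
  · simp
  · simp [Y0]
  · simp [Y0, Y1]
  · simp
    ring

end HalfChain

/-! ### From chains to inscribed pairs -/

section Pairs

variable {m : ℕ}

theorem dvd_val_sub_iff [NeZero m] (i j : ZMod m) (e : ℤ) :
    (2 * m : ℤ) ∣ 2 * (j.val : ℤ) - 2 * (i.val : ℤ) - 2 * e ↔ j = i + e := by
  have h : 2 * (j.val : ℤ) - 2 * (i.val : ℤ) - 2 * e = 2 * ((j.val : ℤ) - i.val - e) := by ring
  rw [h, Int.mul_dvd_mul_iff_left two_ne_zero, ← ZMod.intCast_zmod_eq_zero_iff_dvd]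
  push_cast
  rw [ZMod.natCast_zmod_val, ZMod.natCast_zmod_val, sub_sub, sub_eq_zero]

theorem IsCyclicChain.nonempty_inscribedPair {σ : ℝ} {d x y : ℤ → ℝ} (hσ : 0 < σ)
    (hσ2 : σ * σ = 1 / 2) (hm : 2 ≤ m) (h : IsCyclicChain σ m d x y) :
    Nonempty (InscribedPair m) := by
  have : NeZero m := ⟨by omega⟩
  have hσ1 : σ < 1 := by nlinarith
  choose u hu1 hu2 hu0 using h.exists_functional hσ hσ2 hm
  set z : ℤ → ℝ × ℝ := fun j ↦ (x j, y j) with hz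
  have hper : ∀ k i j, (2 * m : ℤ) ∣ i - j → dot (u k) (z i) = dot (u k) (z j) :=
    fun k i j hij ↦ h.functional_periodic _ _ hij
  have hlt : ∀ k j, dot (u k) (z j) < 1 ∨ (2 * m : ℤ) ∣ j - k ∨ (2 * m : ℤ) ∣ j - (k + 1) ∨
      (2 * m : ℤ) ∣ j - (k - 1) := fun k j ↦ h.lt_one_or hσ hσ2 hm (hu1 k) (hu2 k) (hu0 k) j
  -- Indices of different parity are never congruent modulo `2 * m`, so the exceptions in `hlt`
  -- separate into those for points of the parity of `k` and those for the others.
  have odd : ∀ a : ℤ, ¬ (2 * m : ℤ) ∣ 2 * a + 1 := fun a ha ↦ by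
    have : (2 : ℤ) ∣ 2 * a + 1 := (Dvd.intro _ rfl).trans ha
    omega
  have even_case : ∀ k a : ℤ, dot (u k) (z (k + 2 * a)) < 1 ∨ (2 * m : ℤ) ∣ 2 * a := by
    intro k a
    rcases hlt k (k + 2 * a) with h' | h' | h' | h'
    · exact Or.inl h'
    · exact Or.inr (by simpa using h')
    · exact absurd (by rwa [show k + 2 * a - (k + 1) = 2 * (a - 1) + 1 by ring] at h') (odd (a - 1))
    · exact absurd (by rwa [show k + 2 * a - (k - 1) = 2 * a + 1 by ring] at h') (odd a)
  have odd_case : ∀ k a : ℤ, dot (u k) (z (k + 2 * a + 1)) < 1 ∨ (2 * m : ℤ) ∣ 2 * a ∨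
      (2 * m : ℤ) ∣ 2 * a + 2 := by
    intro k a
    rcases hlt k (k + 2 * a + 1) with h' | h' | h' | h'
    · exact Or.inl h'
    · exact absurd (by rwa [show k + 2 * a + 1 - k = 2 * a + 1 by ring] at h') (odd a)
    · exact Or.inr (Or.inl (by rwa [show k + 2 * a + 1 - (k + 1) = 2 * a by ring] at h'))
    · exact Or.inr (Or.inr (by rwa [show k + 2 * a + 1 - (k - 1) = 2 * a + 2 by ring] at h'))
  have odd_eq : ∀ k a : ℤ, (2 * m : ℤ) ∣ 2 * a ∨ (2 * m : ℤ) ∣ 2 * a + 2 →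
      dot (u k) (z (k + 2 * a + 1)) = 1 := by
    rintro k a (h' | h')
    · rw [hper k _ (k + 1) (by rwa [show k + 2 * a + 1 - (k + 1) = 2 * a by ring])]
      exact hu1 k
    · rw [hper k _ (k - 1) (by rwa [show k + 2 * a + 1 - (k - 1) = 2 * a + 2 by ring])]
      exact hu2 k
  have even_eq : ∀ k a : ℤ, (2 * m : ℤ) ∣ 2 * a → dot (u k) (z (k + 2 * a)) = 2 * σ := by
    intro k a h'
    rw [hper k _ k (by simpa using h')]
    exact hu0 k
  have odd_support : ∀ (k a : ℤ) (p : Prop), ((2 * m : ℤ) ∣ 2 * a ∨ (2 * m : ℤ) ∣ 2 * a + 2 ↔ p) →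
      dot (u k) (z (k + 2 * a + 1)) ≤ 1 ∧ (dot (u k) (z (k + 2 * a + 1)) = 1 ↔ p) := by
    intro k a p hp
    rw [← hp]
    by_cases hd : (2 * m : ℤ) ∣ 2 * a ∨ (2 * m : ℤ) ∣ 2 * a + 2
    · exact ⟨(odd_eq k a hd).le, iff_of_true (odd_eq k a hd) hd⟩
    · have := (odd_case k a).resolve_right hd
      exact ⟨this.le, iff_of_false this.ne hd⟩
  have even_support : ∀ (k a : ℤ) (c : ℝ) (_ : 0 < c) (_ : c ≤ c * (2 * σ)) (p : Prop),
      ((2 * m : ℤ) ∣ 2 * a ↔ p) →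
      c * dot (u k) (z (k + 2 * a)) ≤ c * (2 * σ) ∧
        (c * dot (u k) (z (k + 2 * a)) = c * (2 * σ) ↔ p) := by
    intro k a c hc hc2 p hp
    rw [← hp]
    by_cases hd : (2 * m : ℤ) ∣ 2 * a
    · rw [even_eq k a hd]
      exact ⟨le_rfl, iff_of_true rfl hd⟩
    · have := mul_lt_mul_of_pos_left ((even_case k a).resolve_right hd) hc
      exact ⟨by linarith, iff_of_false (by linarith) hd⟩
  have dsm : ∀ (c : ℝ) (p q : ℝ × ℝ), dot p (c • q) = c * dot p q := fun c p q ↦ by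
    simp only [dot, Prod.smul_fst, Prod.smul_snd, smul_eq_mul]; ring
  have dsm' : ∀ (c : ℝ) (p q : ℝ × ℝ), dot (c • p) q = c * dot p q := fun c p q ↦ by
    simp only [dot, Prod.smul_fst, Prod.smul_snd, smul_eq_mul]; ring
  have hs : σ * (2 * σ) = 1 := by linarith
  have hs' : 2 * σ * (2 * σ) = 2 := by linarith
  -- The even points form the outer polygon and the shrunken odd points the inner one. The factor `2
  -- * σ` compensates the shrinking by `σ`, so that the inner edges get value 1 and the outer
  -- vertices 2σ · 2σ = 2.
  refine ⟨⟨fun i ↦ z (2 * i.val), fun i ↦ σ • z (2 * i.val - 1), fun i ↦ u (2 * i.val - 1),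
    fun i ↦ (2 * σ) • u (2 * i.val), ?_, ?_, ?_, ?_⟩⟩
  · intro i j
    have := odd_support (2 * i.val - 1) (j.val - i.val) (j = i - 1 ∨ j = i) ?_
    · rwa [show (2 * i.val - 1 + 2 * (j.val - i.val) + 1 : ℤ) = 2 * j.val by ring] at this
    · have h1 := dvd_val_sub_iff i j 0
      have h2 := dvd_val_sub_iff i j (-1)
      push_cast at h1 h2
      rw [add_zero] at h1
      rw [← sub_eq_add_neg] at h2
      rw [or_comm, ← h2, ← h1]
      ring_nf
  · intro i j
    have := even_support (2 * i.val - 1) (j.val - i.val) σ hσ (by nlinarith) (j = i) ?_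
    · rw [hs, ← dsm, show (2 * i.val - 1 + 2 * (j.val - i.val) : ℤ) = 2 * j.val - 1 by ring] at this
      exact this
    · have h1 := dvd_val_sub_iff i j 0
      push_cast at h1
      rw [add_zero] at h1
      rw [← h1]
      ring_nf
  · intro i j
    have := odd_support (2 * i.val) (j.val - i.val - 1) (j = i ∨ j = i + 1) ?_
    · rw [show (2 * i.val + 2 * (j.val - i.val - 1) + 1 : ℤ) = 2 * j.val - 1 by ring] at this
      simp only [dsm, dsm', ← mul_assoc]
      rw [show σ * 2 * σ = 1 by linarith, one_mul]
      exact this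
    · have h1 := dvd_val_sub_iff i j 0
      have h2 := dvd_val_sub_iff i j 1
      push_cast at h1 h2
      rw [add_zero] at h1
      rw [or_comm, ← h2, ← h1]
      ring_nf
  · intro i j
    have := even_support (2 * i.val) (j.val - i.val) (2 * σ) (by positivity) (by nlinarith)
      (j = i) ?_
    · rw [hs', ← dsm', show (2 * i.val + 2 * (j.val - i.val) : ℤ) = 2 * j.val by ring] at this
      exact this
    · have h1 := dvd_val_sub_iff i j 0
      push_cast at h1
      rw [add_zero] at h1
      rw [← h1]
      ring_nf

theorem isSupport_zmod_three {f : Fin 3 → ℝ} {c : ℝ} {K : Set (ZMod 3)} (p : Fin 3 → Prop)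
    (hK : ∀ j : Fin 3, p j ↔ (j : ZMod 3) ∈ K)
    (h : ∀ j : Fin 3, f j ≤ c ∧ (f j = c ↔ p j)) : IsSupport (ι := ZMod 3) f c K := fun j ↦
  ⟨(h j).1, (h j).2.trans (hK j)⟩

/-- The closing step of the half chain uses a positive height at index `m - 2`, and the grown
heights are positive only from index 2 on. The triangle therefore needs separate coordinates: the
inner vertices are (a 2 + 3 a 0)/4, (a 0 + 3 a 1)/4 and (a 1 + 7 a 2)/8. -/
theorem nonempty_inscribedPair_three : Nonempty (InscribedPair 3) := by
  refine ⟨⟨(![(7, 0), (0, 7), (-6, -3)] : Fin 3 → ℝ × ℝ),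
    (![(15 / 4, -3 / 4), (7 / 4, 21 / 4), (-21 / 4, -7 / 4)] : Fin 3 → ℝ × ℝ),
    (![(1 / 7, -13 / 21), (1 / 7, 1 / 7), (-5 / 21, 1 / 7)] : Fin 3 → ℝ × ℝ),
    (![(2 / 7, 2 / 21), (-2 / 7, 2 / 7), (2 / 21, -6 / 7)] : Fin 3 → ℝ × ℝ), ?_, ?_, ?_, ?_⟩⟩
  · intro (i : Fin 3)
    refine isSupport_zmod_three (fun j : Fin 3 ↦ j = i - 1 ∨ j = i)
      (fun _ ↦ Iff.rfl) fun j ↦ ?_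
    fin_cases i <;> fin_cases j <;> norm_num [dot] <;> decide
  · intro (i : Fin 3)
    refine isSupport_zmod_three (fun j : Fin 3 ↦ j = i) (fun _ ↦ Iff.rfl) fun j ↦ ?_
    fin_cases i <;> fin_cases j <;> norm_num [dot]
  · intro (i : Fin 3)
    refine isSupport_zmod_three (fun j : Fin 3 ↦ j = i ∨ j = i + 1)
      (fun _ ↦ Iff.rfl) fun j ↦ ?_
    fin_cases i <;> fin_cases j <;> norm_num [dot] <;> decide
  · intro (i : Fin 3)
    refine isSupport_zmod_three (fun j : Fin 3 ↦ j = i) (fun _ ↦ Iff.rfl) fun j ↦ ?_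
    fin_cases i <;> fin_cases j <;> norm_num [dot]

theorem nonempty_inscribedPair (hm : 3 ≤ m) : Nonempty (InscribedPair m) := by
  rcases hm.eq_or_lt with rfl | hm
  · exact nonempty_inscribedPair_three
  obtain ⟨k, rfl⟩ : ∃ k, m = k + 4 := ⟨m - 4, by omega⟩
  have hσ : 0 < √(1 / 2 : ℝ) := Real.sqrt_pos.2 (by norm_num)
  have hσ2 : √(1 / 2 : ℝ) * √(1 / 2 : ℝ) = 1 / 2 := Real.mul_self_sqrt (by norm_num)
  obtain ⟨d, x, y, h⟩ := exists_isHalfChain hσ hσ2 k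
  obtain ⟨d', x', y', h'⟩ := h.isCyclicChain (by omega)
  exact h'.nonempty_inscribedPair hσ hσ2 (by omega)

end Pairs

end EConstruction

theorem theorem3p1 (m n : ℕ) (hm : 3 ≤ m) (hn : 3 ≤ n)
    (C D : Set (EuclideanSpace ℝ (Fin 2)))
    (hC : EConstruction.IsPolygon m C) (hD : EConstruction.IsPolygon n D) :
    EConstruction.IsPolytopal 4 (EConstruction.ESphere (C ×ˢ D)) := by
  obtain ⟨P⟩ := EConstruction.nonempty_inscribedPair hm
  obtain ⟨P'⟩ := EConstruction.nonempty_inscribedPair hn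
  exact EConstruction.isPolytopal_of_inscribedPair hm hn P P' hC hD
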